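/- For every $C_\Omega>0$ there is a constant $C>0$, depending only on $C_\Omega$, such that the following holds. Let $T>0$, $C_{\partial\Omega}>0$, and for each $t\in[0,T]$ let $\Omega(t)\subset\mathbb R$ be a bounded open set (not necessarily connected) with $|\Omega(t)|\le C_\Omega$ and $|\partial\Omega(t)|\le C_{\partial\Omega}$, where $|\Omega(t)|$ is the Lebesgue measure and $|\partial\Omega(t)|$ the number of points. Put $$Q=\{(x,t): 0<t<T,\ x\in\Omega(t)\},\qquad \Sigma_s=\{(x,t): 0<t<T,\ x\in\partial\Omega(t)\},$$ and assume that $Q$ is open in $\mathbb R^2$. Assume moreover that there are finitely many bounded sets $O_1,\dots,O_N\subset\mathbb R^2$, each open or closed, whose union contains an open set containing $\Sigma_s$, and for each $i$ numbers $0\le\alpha_i$ and $\beta_i$ with $O_i\subset\{\alpha_i\le t\le\beta_i\}$ and a $C^2$-diffeomorphism $h_i$ from $\overline{O_i}$ onto $\overline{B_i}$, $B_i=\{(\xi,\tau): -1<\xi<1,\ \alpha_i<\tau<\beta_i\}$, of the form $h_i(x,t)=(\xi_i(x,t),t)$, which maps $\overline{Q\cap O_i}$ bijectively onto $\overline{B_i}\cap\{\xi\ge0\}$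 and $\overline{\Sigma_s\cap O_i}$ bijectively onto $\overline{B_i}\cap\{\xi=0\}$. Let $H^{1,0}(Q)=\{u\in L^2(Q):\partial_x u\in L^2(Q)\}$ (weak derivative), with $\|u\|_{H^{1,0}(Q)}^2=2\|u\|_Q^2+\|\partial_x u\|_Q^2$, where $\|\cdot\|_Q$ is the norm of $L^2(Q)$, and let $\|\cdot\|_{\Sigma_s}$ be the norm of $L^2(\Sigma_s)$ with respect to arc length (the one-dimensional Hausdorff measure of the Euclidean plane). Then there is exactly one continuous linear operator $\gamma_s:H^{1,0}(Q)\to L^2(\Sigma_s)$ with $\gamma_s\varphi=\varphi|_{\Sigma_s}$ for all $\varphi\in C^1(\overline Q)$, and $$\|u\|_Q\le C\left(\|\partial_x u\|_Q+\|\gamma_s u\|_{\Sigma_s}\right)\qquad\text{for all }u\in H^{1,0}(Q).$$ -/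

import Mathlib

open MeasureTheory Set
open scoped ContDiff

noncomputable section

/-! Points of space-time are pairs `z = (x, t) : ℝ × ℝ`, with `x` the space and `t` the time variable. -/

/-- The space-time domain `Q = {(x, t) : 0 < t < T, x ∈ Ω(t)}`. -/
def spaceTime (Ω : ℝ → Set ℝ) (T : ℝ) : Set (ℝ × ℝ) :=
  {z | z.2 ∈ Ioo 0 T ∧ z.1 ∈ Ω z.2}

/-- The lateral boundary `Σ_s = {(x, t) : 0 < t < T, x ∈ ∂Ω(t)}`. -/
def lateral (Ω : ℝ → Set ℝ) (T : ℝ) : Set (ℝ × ℝ) :=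
  {z | z.2 ∈ Ioo 0 T ∧ z.1 ∈ frontier (Ω z.2)}

/-- The arc-length measure on a set `S` of the plane: the one-dimensional Hausdorff measure of the
Euclidean plane (the metric of `ℝ × ℝ` itself is the maximum metric), restricted to `S`. -/
def arcLength (S : Set (ℝ × ℝ)) : Measure (ℝ × ℝ) :=
  ((Measure.hausdorffMeasure 1 : Measure (WithLp 2 (ℝ × ℝ))).map WithLp.ofLp).restrict S

/-- The uniform bounds `|Ω(t)| ≤ C_Ω` (length) and `|∂Ω(t)| ≤ C_∂Ω` (number of points). -/
def UniformBounds (Ω : ℝ → Set ℝ) (T CΩ CdΩ : ℝ) : Prop :=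
  ∀ t ∈ Icc 0 T, volume (Ω t) ≤ ENNReal.ofReal CΩ ∧
    Measure.count (frontier (Ω t)) ≤ ENNReal.ofReal CdΩ

/-- The box `B(α, β) = {(ξ, τ) : -1 < ξ < 1, α < τ < β}`. -/
def box (α β : ℝ) : Set (ℝ × ℝ) := Ioo (-1) 1 ×ˢ Ioo α β

/-- `h` is a time-preserving `C²`-diffeomorphism of `closure O` onto `closure (box α β)` that
flattens the lateral boundary `S` of `Q` to `{ξ = 0}` and sends `Q` to the side `{ξ ≥ 0}`. -/
structure IsLateralChart (Q S O : Set (ℝ × ℝ)) (α β : ℝ) (h : ℝ × ℝ → ℝ × ℝ) : Prop where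
  isOpen_or_isClosed : IsOpen O ∨ IsClosed O
  isBounded : Bornology.IsBounded O
  nonneg : 0 ≤ α
  strip : ∀ z ∈ O, z.2 ∈ Icc α β
  contDiffOn : ContDiffOn ℝ 2 h (closure O)
  bijOn : BijOn h (closure O) (closure (box α β))
  contDiffOn_inv : ContDiffOn ℝ 2 (Function.invFunOn h (closure O)) (closure (box α β))
  time : ∀ z ∈ closure O, (h z).2 = z.2
  bijOn_domain : BijOn h (closure (Q ∩ O)) (closure (box α β) ∩ {w | 0 ≤ w.1})
  bijOn_lateral : BijOn h (closure (S ∩ O)) (closure (box α β) ∩ {w | w.1 = 0})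

/-- Finitely many charts whose domains cover a neighbourhood of the lateral boundary. -/
def HasLateralCharts (Q S : Set (ℝ × ℝ)) : Prop :=
  ∃ (N : ℕ) (O : Fin N → Set (ℝ × ℝ)) (α β : Fin N → ℝ) (h : Fin N → ℝ × ℝ → ℝ × ℝ),
    (∃ V : Set (ℝ × ℝ), IsOpen V ∧ S ⊆ V ∧ V ⊆ ⋃ i, O i) ∧
    ∀ i, IsLateralChart Q S (O i) (α i) (β i) (h i)

/-- `L²(Q)` for Lebesgue measure on the plane. -/
abbrev L2 (Q : Set (ℝ × ℝ)) : Type := Lp ℝ 2 ((volume : Measure (ℝ × ℝ)).restrict Q)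

/-- `L²(S)` for the arc-length measure. -/
abbrev L2Lateral (S : Set (ℝ × ℝ)) : Type := Lp ℝ 2 (arcLength S)

/-- `g` is the weak space derivative `∂ₓ u` in `Q`. -/
def IsWeakDx (Q : Set (ℝ × ℝ)) (u g : L2 Q) : Prop :=
  ∀ φ : ℝ × ℝ → ℝ, ContDiff ℝ ∞ φ → HasCompactSupport φ → tsupport φ ⊆ Q →
    ∫ z in Q, u z * fderiv ℝ φ z (1, 0) = -∫ z in Q, g z * φ z

lemma integrable_mul_test {Q : Set (ℝ × ℝ)} (u : L2 Q) {ψ : ℝ × ℝ → ℝ}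
    (hψ : Continuous ψ) (hc : HasCompactSupport ψ) :
    Integrable (fun z => u z * ψ z) ((volume : Measure (ℝ × ℝ)).restrict Q) :=
  (Lp.memLp u).integrable_mul (q := 2)
    ((hψ.memLp_of_hasCompactSupport (p := 2) hc).restrict Q)

lemma continuous_dx_test {φ : ℝ × ℝ → ℝ} (hφ : ContDiff ℝ ∞ φ) :
    Continuous fun z => fderiv ℝ φ z (1, 0) :=
  (hφ.continuous_fderiv (by simp)).clm_apply continuous_const

lemma IsWeakDx.zero (Q : Set (ℝ × ℝ)) : IsWeakDx Q 0 0 := by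
  intro φ _ _ _
  have h0 : ((0 : L2 Q) : ℝ × ℝ → ℝ) =ᵐ[volume.restrict Q] 0 := Lp.coeFn_zero _ _ _
  rw [integral_congr_ae (g := 0) (h0.mono fun z hz => by rw [hz]; simp),
    integral_congr_ae (f := fun z => ((0 : L2 Q) z) * φ z) (g := 0)
      (h0.mono fun z hz => by beta_reduce; rw [hz]; simp)]
  simp

lemma IsWeakDx.add {Q : Set (ℝ × ℝ)} {u v g k : L2 Q} (hu : IsWeakDx Q u g)
    (hv : IsWeakDx Q v k) : IsWeakDx Q (u + v) (g + k) := by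
  intro φ hφ hc hs
  have hc' : HasCompactSupport fun z => fderiv ℝ φ z (1, 0) := hc.fderiv_apply ℝ _
  have hd := continuous_dx_test hφ
  rw [integral_congr_ae (g := fun z => u z * fderiv ℝ φ z (1, 0) + v z * fderiv ℝ φ z (1, 0))
      ((Lp.coeFn_add u v).mono fun z hz => by beta_reduce; rw [hz, Pi.add_apply, add_mul]),
    integral_congr_ae (f := fun z => (g + k : L2 Q) z * φ z)
      (g := fun z => g z * φ z + k z * φ z)
      ((Lp.coeFn_add g k).mono fun z hz => by beta_reduce; rw [hz, Pi.add_apply, add_mul]),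
    integral_add (integrable_mul_test u hd hc') (integrable_mul_test v hd hc'),
    integral_add (integrable_mul_test g hφ.continuous hc)
      (integrable_mul_test k hφ.continuous hc), hu φ hφ hc hs, hv φ hφ hc hs]
  ring

lemma IsWeakDx.smul {Q : Set (ℝ × ℝ)} {u g : L2 Q} (c : ℝ) (hu : IsWeakDx Q u g) :
    IsWeakDx Q (c • u) (c • g) := by
  intro φ hφ hc hs
  rw [integral_congr_ae (g := fun z => c * (u z * fderiv ℝ φ z (1, 0)))
      ((Lp.coeFn_smul c u).mono fun z hz => by
        beta_reduce; rw [hz, Pi.smul_apply, smul_eq_mul, mul_assoc]),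
    integral_congr_ae (f := fun z => (c • g : L2 Q) z * φ z) (g := fun z => c * (g z * φ z))
      ((Lp.coeFn_smul c g).mono fun z hz => by
        beta_reduce; rw [hz, Pi.smul_apply, smul_eq_mul, mul_assoc]),
    integral_const_mul, integral_const_mul, hu φ hφ hc hs]
  ring

/-- The anisotropic Sobolev space `H^{1,0}(Q) = {u ∈ L²(Q) : ∂ₓ u ∈ L²(Q)}`. -/
def H10 (Q : Set (ℝ × ℝ)) : Submodule ℝ (L2 Q) where
  carrier := {u | ∃ g, IsWeakDx Q u g}
  zero_mem' := ⟨0, IsWeakDx.zero Q⟩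
  add_mem' := fun ⟨g, hg⟩ ⟨k, hk⟩ => ⟨g + k, hg.add hk⟩
  smul_mem' := fun c _ ⟨g, hg⟩ => ⟨c • g, hg.smul c⟩

/-- The weak space derivative `∂ₓ u ∈ L²(Q)` of `u ∈ H^{1,0}(Q)` (unique when `Q` is open). -/
def dx {Q : Set (ℝ × ℝ)} (u : H10 Q) : L2 Q := Classical.choose u.2

/-- The norm of `H^{1,0}(Q)`; `‖u‖²` is counted once as a space derivative and once as a time
derivative of order zero. -/
def h10Norm {Q : Set (ℝ × ℝ)} (u : H10 Q) : ℝ :=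
  √((‖(u : L2 Q)‖ ^ 2 + ‖dx u‖ ^ 2) + ‖(u : L2 Q)‖ ^ 2)

/-- `γ : H^{1,0}(Q) → L²(S)` is a trace operator: linear, continuous, and equal to the pointwise
restriction `φ ↦ φ|_S` on `C¹(closure Q)`. -/
def IsTraceOperator (Q S : Set (ℝ × ℝ)) (γ : H10 Q →ₗ[ℝ] L2Lateral S) : Prop :=
  (∃ K : ℝ, ∀ u, ‖γ u‖ ≤ K * h10Norm u) ∧
  ∀ φ : ℝ × ℝ → ℝ, ContDiffOn ℝ 1 φ (closure Q) →
    ∀ u : H10 Q, ((u : L2 Q) : ℝ × ℝ → ℝ) =ᵐ[volume.restrict Q] φ →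
      (γ u : ℝ × ℝ → ℝ) =ᵐ[arcLength S] φ

end

/-!
The charts give finitely many Lipschitz curves `x = c i t` carrying the lateral boundary and, off
finitely many times, a `δ > 0` such that every boundary point of `Ω(t)` has an interval of length
`δ` in `Ω(t)` on one side and an interval of length `δ` outside `Ω(t)` on the other.

For functions in `C¹(closure Q)`, integrating `∂ₓφ` along a slice from a boundary point bounds
`‖φ‖_Q`; as arc length on a graph over the time axis is at least `dt`, the constant depends on
`C_Ω` only. Averaging over the inner intervals bounds the trace by `‖φ‖_Q + ‖∂ₓφ‖_Q`, now with a
constant depending on `δ`, the Lipschitz constant and the number of curves.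

Both bounds extend to `H^{1,0}(Q)` because `C¹(closure Q)` is dense in it. Suppose `(f, h)` in
`L² × L²` is orthogonal to all `(φ, ∂ₓφ)`. Extended by zero, `f` and `h` satisfy `∂ₓh = f` on the
whole plane, so on almost every slice `h` is a primitive of `f`. It vanishes on the outer
intervals, hence at both ends of each component of `Ω(t)`, and integration by parts on the
components shows that `(f, h)` is orthogonal to `(u, ∂ₓu)` for every `u` in `H^{1,0}(Q)`.
-/

open Filter Topology
open scoped ENNReal NNReal

/-- The section of a space-time set at time `t`. -/
def timeSlice (Q : Set (ℝ × ℝ)) (t : ℝ) : Set ℝ := {x | (x, t) ∈ Q}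

/-- The lateral boundary of a space-time set: the union of the boundaries of its time slices. -/
def lateralFrontier (Q : Set (ℝ × ℝ)) : Set (ℝ × ℝ) := {z | z.1 ∈ frontier (timeSlice Q z.2)}

lemma timeSlice_spaceTime_of_mem {Ω : ℝ → Set ℝ} {T t : ℝ} (ht : t ∈ Ioo 0 T) :
    timeSlice (spaceTime Ω T) t = Ω t :=
  ext fun _ => and_iff_right ht

lemma timeSlice_spaceTime_of_notMem {Ω : ℝ → Set ℝ} {T t : ℝ} (ht : t ∉ Ioo 0 T) :
    timeSlice (spaceTime Ω T) t = ∅ :=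
  eq_empty_of_forall_notMem fun _ h => ht h.1

lemma lateral_eq_lateralFrontier (Ω : ℝ → Set ℝ) (T : ℝ) :
    lateral Ω T = lateralFrontier (spaceTime Ω T) := by
  ext z
  by_cases ht : z.2 ∈ Ioo 0 T
  · simp only [lateral, lateralFrontier, timeSlice_spaceTime_of_mem ht, mem_ofPred_eq]
    exact and_iff_right ht
  · simp only [lateral, lateralFrontier, timeSlice_spaceTime_of_notMem ht, mem_ofPred_eq,
      frontier_empty, mem_empty_iff_false, iff_false]
    exact fun h => ht h.1

lemma isOpen_timeSlice {Q : Set (ℝ × ℝ)} (hQ : IsOpen Q) (t : ℝ) : IsOpen (timeSlice Q t) :=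
  hQ.preimage (by fun_prop : Continuous fun x : ℝ => (x, t))

lemma isBounded_timeSlice {Q : Set (ℝ × ℝ)} (hQ : Bornology.IsBounded Q) (t : ℝ) :
    Bornology.IsBounded (timeSlice Q t) :=
  hQ.image_fst.subset fun x hx => mem_image_of_mem Prod.fst (show (x, t) ∈ Q from hx)

lemma measurableSet_timeSlice {Q : Set (ℝ × ℝ)} (hQ : MeasurableSet Q) (t : ℝ) :
    MeasurableSet (timeSlice Q t) := (by fun_prop : Measurable fun x : ℝ => (x, t)) hQ

lemma mk_mem_closure_of_mem_closure_timeSlice {Q : Set (ℝ × ℝ)} {x t : ℝ}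
    (h : x ∈ closure (timeSlice Q t)) : (x, t) ∈ closure Q :=
  map_mem_closure (f := fun x : ℝ => (x, t)) (by fun_prop) h fun _ hy => hy

lemma lateralFrontier_subset_closure (Q : Set (ℝ × ℝ)) : lateralFrontier Q ⊆ closure Q :=
  fun _ hz => mk_mem_closure_of_mem_closure_timeSlice (frontier_subset_closure hz)

lemma measurableSet_lateralFrontier {Q : Set (ℝ × ℝ)} (hQ : IsOpen Q) :
    MeasurableSet (lateralFrontier Q) := by
  have h_eq : lateralFrontier Q =
      (⋂ n : ℕ, ⋃ y : ℝ, {z | dist z.1 y < 1 / ((n : ℝ) + 1)} ∩ {z | (y, z.2) ∈ Q}) \ Q := by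
    ext z
    change z.1 ∈ frontier _ ↔ _
    rw [(isOpen_timeSlice hQ z.2).frontier_eq]
    refine and_congr ?_ Iff.rfl
    simp only [Metric.mem_closure_iff, mem_iInter, mem_iUnion]
    refine ⟨fun h n => ?_, fun h ε hε => ?_⟩
    · obtain ⟨y, hy, hd⟩ := h _ Nat.one_div_pos_of_nat
      exact ⟨y, hd, hy⟩
    · obtain ⟨n, hn⟩ := exists_nat_one_div_lt hε
      obtain ⟨y, hd, hy⟩ := h n
      exact ⟨y, hy, lt_trans hd hn⟩
  have h_open (n : ℕ) : IsOpen
      (⋃ y : ℝ, {z : ℝ × ℝ | dist z.1 y < 1 / ((n : ℝ) + 1)} ∩ {z | (y, z.2) ∈ Q}) :=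
    isOpen_iUnion fun y => (isOpen_lt (by fun_prop) continuous_const).inter
      (hQ.preimage (by fun_prop))
  rw [h_eq]
  exact (MeasurableSet.iInter fun n => (h_open n).measurableSet).diff hQ.measurableSet

lemma exists_mem_inter_frontier_of_isPreconnected {X : Type*} [TopologicalSpace X] {s u : Set X}
    (hs : IsPreconnected s) (h1 : (s ∩ u).Nonempty) (h2 : ¬ s ⊆ u) : (s ∩ frontier u).Nonempty := by
  have : PreconnectedSpace s := Subtype.preconnectedSpace hs
  obtain ⟨x, hxs, hxu⟩ := h1
  obtain ⟨y, hys, hyu⟩ := not_subset.1 h2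
  obtain ⟨w, hw⟩ : (frontier (Subtype.val ⁻¹' u : Set s)).Nonempty := nonempty_frontier_iff.2
    ⟨⟨⟨x, hxs⟩, hxu⟩, (ne_univ_iff_exists_notMem _).2 ⟨⟨y, hys⟩, hyu⟩⟩
  exact ⟨w, w.2, continuous_subtype_val.frontier_preimage_subset u hw⟩

lemma exists_mem_frontier_Ico_subset {A : Set ℝ} (hA : IsOpen A) (hb : BddAbove A) {x : ℝ}
    (hx : x ∈ A) : ∃ y ∈ frontier A, x < y ∧ Ico x y ⊆ A := by
  obtain ⟨M, hM⟩ := hb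
  have h_bdd : BddBelow (Aᶜ ∩ Ici x) := bddBelow_Ici.mono inter_subset_right
  have h_mem : sInf (Aᶜ ∩ Ici x) ∈ Aᶜ ∩ Ici x :=
    (hA.isClosed_compl.inter isClosed_Ici).csInf_mem
      ⟨M + 1, fun h => by linarith [hM h], mem_Ici.2 (by linarith [hM hx])⟩ h_bdd
  have h_lt : x < sInf (Aᶜ ∩ Ici x) := lt_of_le_of_ne h_mem.2 fun h => h_mem.1 (h ▸ hx)
  have h_sub : Ico x (sInf (Aᶜ ∩ Ici x)) ⊆ A := fun w hw => by
    by_contra hwA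
    exact notMem_of_lt_csInf hw.2 h_bdd ⟨hwA, hw.1⟩
  refine ⟨_, hA.frontier_eq ▸ ⟨closure_mono h_sub ?_, h_mem.1⟩, h_lt, h_sub⟩
  rw [closure_Ico h_lt.ne]
  exact right_mem_Icc.2 h_lt.le

lemma exists_mem_frontier_Ioc_subset {A : Set ℝ} (hA : IsOpen A) (hb : BddBelow A) {x : ℝ}
    (hx : x ∈ A) : ∃ y ∈ frontier A, y < x ∧ Ioc y x ⊆ A := by
  obtain ⟨y, hy, hxy, h_sub⟩ := exists_mem_frontier_Ico_subset hA.neg hb.neg (neg_mem_neg.2 hx)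
  refine ⟨-y, ?_, neg_lt.1 hxy, fun w hw => neg_mem_neg.1 (h_sub
    ⟨neg_le_neg hw.2, neg_lt.1 hw.1⟩)⟩
  exact ((Homeomorph.neg ℝ).preimage_frontier A).symm.subset hy

lemma isBounded_of_isBounded_lateralFrontier {Q : Set (ℝ × ℝ)} (hQ : IsOpen Q)
    (hb : ∀ t, Bornology.IsBounded (timeSlice Q t))
    (hS : Bornology.IsBounded (lateralFrontier Q)) : Bornology.IsBounded Q := by
  obtain ⟨R, hR⟩ := hS.subset_closedBall 0
  refine Metric.isBounded_closedBall.subset (t := Metric.closedBall (0 : ℝ × ℝ) R) ?_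
  rintro ⟨x, t⟩ hx
  obtain ⟨y, hy, hxy, -⟩ := exists_mem_frontier_Ico_subset (isOpen_timeSlice hQ t)
    (hb t).bddAbove hx
  obtain ⟨w, hw, hwx, -⟩ := exists_mem_frontier_Ioc_subset (isOpen_timeSlice hQ t)
    (hb t).bddBelow hx
  have hyR := hR (show (y, t) ∈ lateralFrontier Q from hy)
  have hwR := hR (show (w, t) ∈ lateralFrontier Q from hw)
  simp only [mem_closedBall_zero_iff, Prod.norm_mk, sup_le_iff, Real.norm_eq_abs, abs_le]
    at hyR hwR ⊢
  exact ⟨⟨by linarith, by linarith⟩, hyR.2⟩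

lemma mem_uIoo_of_notMem {a b c y : ℝ} (hc : c ∈ uIoo a b) (hy : y ∈ uIoo a b) (hne : y ≠ c)
    (hn : y ∉ uIoo a c) : y ∈ uIoo c b := by
  simp only [uIoo_eq_union, mem_union, mem_Ioo] at *
  grind

lemma closure_box {α β : ℝ} (h : α < β) : closure (box α β) = Icc (-1) 1 ×ˢ Icc α β := by
  rw [box, closure_prod_eq, closure_Ioo (by norm_num), closure_Ioo h.ne]

/-- The curve `x = levelCurve h O ξ t` in the domain of a lateral chart `h` on `O` along which the
first component of `h` equals `ξ`; the lateral boundary is the curve of level `0`. -/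
noncomputable def levelCurve (h : ℝ × ℝ → ℝ × ℝ) (O : Set (ℝ × ℝ)) (ξ t : ℝ) : ℝ :=
  (Function.invFunOn h (closure O) (ξ, t)).1

/-- The outer half of a lateral chart: the points between the curves of level `-1` and `0`. -/
def outerStrip (h : ℝ × ℝ → ℝ × ℝ) (O : Set (ℝ × ℝ)) (α β : ℝ) : Set (ℝ × ℝ) :=
  {z | z.2 ∈ Ioo α β ∧ z.1 ∈ uIoo (levelCurve h O (-1) z.2) (levelCurve h O 0 z.2)}

namespace IsLateralChart

variable {Q S O : Set (ℝ × ℝ)} {α β ξ η t : ℝ} {h : ℝ × ℝ → ℝ × ℝ}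

lemma lt_of_mem (H : IsLateralChart Q S O α β h) {z : ℝ × ℝ} (hz : z ∈ O) : α < β := by
  have hhz := H.bijOn.mapsTo (subset_closure hz)
  by_contra hle
  rw [box, Ioo_eq_empty hle] at hhz
  simp at hhz

lemma invFunOn_eq (H : IsLateralChart Q S O α β h) (hξt : (ξ, t) ∈ closure (box α β)) :
    Function.invFunOn h (closure O) (ξ, t) = (levelCurve h O ξ t, t) := by
  refine Prod.ext rfl ?_
  rw [← H.time _ (H.bijOn.surjOn.mapsTo_invFunOn hξt), H.bijOn.invOn_invFunOn.2 hξt]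

lemma mk_levelCurve_mem (H : IsLateralChart Q S O α β h) (hξt : (ξ, t) ∈ closure (box α β)) :
    (levelCurve h O ξ t, t) ∈ closure O :=
  H.invFunOn_eq hξt ▸ H.bijOn.surjOn.mapsTo_invFunOn hξt

lemma apply_mk_levelCurve (H : IsLateralChart Q S O α β h) (hξt : (ξ, t) ∈ closure (box α β)) :
    h (levelCurve h O ξ t, t) = (ξ, t) :=
  H.invFunOn_eq hξt ▸ H.bijOn.invOn_invFunOn.2 hξt

lemma levelCurve_apply (H : IsLateralChart Q S O α β h) {z : ℝ × ℝ} (hz : z ∈ closure O) :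
    levelCurve h O (h z).1 z.2 = z.1 := by
  rw [levelCurve, ← H.time z hz, H.bijOn.invOn_invFunOn.1 hz]

lemma injOn_levelCurve (H : IsLateralChart Q S O α β h) (hαβ : α < β) (ht : t ∈ Icc α β) :
    InjOn (fun ξ => levelCurve h O ξ t) (Icc (-1) 1) := fun ξ hξ η hη h_eq => by
  have h_apply := H.apply_mk_levelCurve (closure_box hαβ ▸ mk_mem_prod hξ ht)
  rw [show levelCurve h O ξ t = _ from h_eq,
    H.apply_mk_levelCurve (closure_box hαβ ▸ mk_mem_prod hη ht)] at h_apply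
  exact (congrArg Prod.fst h_apply).symm

lemma continuousOn_levelCurve (H : IsLateralChart Q S O α β h) (hαβ : α < β) :
    ContinuousOn (fun w : ℝ × ℝ => levelCurve h O w.1 w.2) (Icc (-1) 1 ×ˢ Icc α β) :=
  continuous_fst.comp_continuousOn (closure_box hαβ ▸ H.contDiffOn_inv.continuousOn)

lemma exists_lipschitzOnWith_levelCurve (H : IsLateralChart Q S O α β h) (hαβ : α < β)
    (hξ : ξ ∈ Icc (-1) 1) : ∃ K, LipschitzOnWith K (levelCurve h O ξ) (Icc α β) := by
  have h_smooth : ContDiffOn ℝ 2 (levelCurve h O ξ) (Icc α β) :=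
    contDiff_fst.comp_contDiffOn (H.contDiffOn_inv.comp (contDiff_prodMk_right ξ).contDiffOn
      fun t ht => closure_box hαβ ▸ mk_mem_prod hξ ht)
  exact h_smooth.exists_lipschitzOnWith (by norm_num) (convex_Icc α β) isCompact_Icc

lemma exists_le_abs_levelCurve_sub (H : IsLateralChart Q S O α β h) (hαβ : α < β)
    (hξ : ξ ∈ Icc (-1) 1) (hη : η ∈ Icc (-1) 1) (hne : ξ ≠ η) :
    ∃ δ > 0, ∀ t ∈ Icc α β, δ ≤ |levelCurve h O ξ t - levelCurve h O η t| := by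
  have h_cont {ζ : ℝ} (hζ : ζ ∈ Icc (-1) 1) : ContinuousOn (levelCurve h O ζ) (Icc α β) :=
    (H.continuousOn_levelCurve hαβ).comp (f := fun t => (ζ, t)) (by fun_prop)
      fun _ ht => mk_mem_prod hζ ht
  obtain ⟨t₀, ht₀, h_min⟩ := isCompact_Icc.exists_isMinOn (nonempty_Icc.2 hαβ.le)
    ((h_cont hξ).sub (h_cont hη)).abs
  exact ⟨_, abs_pos.2 (sub_ne_zero.2 ((H.injOn_levelCurve hαβ ht₀).ne hξ hη hne)),
    fun t ht => h_min ht⟩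

lemma exists_levelCurve_eq (H : IsLateralChart Q S O α β h) (hξ : ξ ∈ Icc (-1) 1)
    (hη : η ∈ Icc (-1) 1) (hle : ξ ≤ η) (ht : t ∈ Ioo α β) {x : ℝ}
    (hx : x ∈ uIoo (levelCurve h O ξ t) (levelCurve h O η t)) :
    ∃ ζ ∈ Ioo ξ η, (ζ, t) ∈ closure (box α β) ∧ levelCurve h O ζ t = x := by
  have hαβ := ht.1.trans ht.2
  have h_sub : Icc ξ η ⊆ Icc (-1) 1 := Icc_subset_Icc hξ.1 hη.2
  have h_cont : ContinuousOn (fun ζ => levelCurve h O ζ t) (uIcc ξ η) :=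
    (H.continuousOn_levelCurve hαβ).comp (f := fun ζ => (ζ, t)) (by fun_prop)
      fun ζ hζ => ⟨h_sub (uIcc_of_le hle ▸ hζ), Ioo_subset_Icc_self ht⟩
  obtain ⟨ζ, hζ, rfl⟩ := intermediate_value_uIcc h_cont (uIoo_subset_uIcc_self hx)
  rw [uIcc_of_le hle] at hζ
  have h_ne_left : ξ ≠ ζ := by rintro rfl; simp at hx
  have h_ne_right : ζ ≠ η := by rintro rfl; simp at hx
  exact ⟨ζ, ⟨lt_of_le_of_ne hζ.1 h_ne_left, lt_of_le_of_ne hζ.2 h_ne_right⟩,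
    closure_box hαβ ▸ ⟨h_sub hζ, Ioo_subset_Icc_self ht⟩, rfl⟩

lemma levelCurve_zero_mem_uIoo (H : IsLateralChart Q S O α β h) (ht : t ∈ Ioo α β) :
    levelCurve h O 0 t ∈ uIoo (levelCurve h O (-1) t) (levelCurve h O 1 t) := by
  have hαβ := ht.1.trans ht.2
  have ht' := Ioo_subset_Icc_self ht
  have h_cont : ContinuousOn (fun ζ => levelCurve h O ζ t) (Icc (-1) 1) :=
    (H.continuousOn_levelCurve hαβ).comp (f := fun ζ => (ζ, t)) (by fun_prop)
      fun ζ hζ => ⟨hζ, ht'⟩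
  rcases h_cont.strictMonoOn_of_injOn_Icc' (by norm_num) (H.injOn_levelCurve hαβ ht')
    with h_mono | h_anti
  · exact mem_uIoo_of_lt (h_mono (by simp) (by simp) neg_one_lt_zero)
      (h_mono (by simp) (by simp) one_pos)
  · exact mem_uIoo_of_gt (h_anti (by simp) (by simp) one_pos)
      (h_anti (by simp) (by simp) neg_one_lt_zero)

lemma levelCurve_zero_of_mem (H : IsLateralChart Q S O α β h) {z : ℝ × ℝ} (hz : z ∈ S ∩ O) :
    levelCurve h O 0 z.2 = z.1 := by
  rw [← (H.bijOn_lateral.mapsTo (subset_closure hz)).2, H.levelCurve_apply (subset_closure hz.2)]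

lemma isOpen_outerStrip (H : IsLateralChart Q S O α β h) : IsOpen (outerStrip h O α β) := by
  rcases le_or_gt β α with hle | hαβ
  · simp [outerStrip, Ioo_eq_empty_of_le hle]
  have h_cont {ξ : ℝ} (hξ : ξ ∈ Icc (-1) 1) :
      ContinuousOn (fun z : ℝ × ℝ => levelCurve h O ξ z.2) (Prod.snd ⁻¹' Ioo α β) :=
    (H.continuousOn_levelCurve hαβ).comp (f := fun z : ℝ × ℝ => (ξ, z.2)) (by fun_prop)
      fun z hz => ⟨hξ, Ioo_subset_Icc_self hz⟩
  have h_left := h_cont (ξ := -1) (by simp)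
  have h_right := h_cont (ξ := 0) (by simp)
  have h_open : IsOpen (Prod.snd ⁻¹' Ioo α β : Set (ℝ × ℝ)) := isOpen_Ioo.preimage continuous_snd
  have h_lower := (continuous_fst.continuousOn.sub (h_left.inf h_right)).isOpen_inter_preimage
    h_open (isOpen_Ioi (a := 0))
  have h_upper := ((h_left.sup h_right).sub continuous_fst.continuousOn).isOpen_inter_preimage
    h_open (isOpen_Ioi (a := 0))
  convert h_lower.inter h_upper using 1
  ext z
  simp only [outerStrip, uIoo, mem_ofPred_eq, mem_inter_iff, mem_preimage, mem_Ioo, mem_Ioi,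
    sub_pos, Pi.sub_apply]
  tauto

lemma mem_closure_and_fst_neg_of_mem_outerStrip (H : IsLateralChart Q S O α β h) {z : ℝ × ℝ}
    (hz : z ∈ outerStrip h O α β) : z ∈ closure O ∧ (h z).1 < 0 := by
  obtain ⟨ζ, hζ, h_box, h_eq⟩ := H.exists_levelCurve_eq (by simp) (by simp) (by simp) hz.1 hz.2
  have hz_eq : (levelCurve h O ζ z.2, z.2) = z := Prod.ext h_eq rfl
  exact ⟨hz_eq ▸ H.mk_levelCurve_mem h_box,
    by rw [← hz_eq, H.apply_mk_levelCurve h_box]; exact hζ.2⟩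

lemma disjoint_outerStrip (H : IsLateralChart Q S O α β h) (hQ : IsOpen Q) :
    Disjoint (outerStrip h O α β) Q := disjoint_left.2 fun z hz hzQ => by
  obtain ⟨w, ⟨hw, hwQ⟩, hwO⟩ := mem_closure_iff.1
    (H.mem_closure_and_fst_neg_of_mem_outerStrip hz).1 _ (H.isOpen_outerStrip.inter hQ) ⟨hz, hzQ⟩
  exact (H.mem_closure_and_fst_neg_of_mem_outerStrip hw).2.not_ge
    (H.bijOn_domain.mapsTo (subset_closure ⟨hwQ, hwO⟩)).2

lemma mk_mem_closure_of_mem_uIoo (H : IsLateralChart Q S O α β h) (ht : t ∈ Ioo α β) {x : ℝ}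
    (hx : x ∈ uIoo (levelCurve h O 0 t) (levelCurve h O 1 t)) : (x, t) ∈ closure Q := by
  obtain ⟨ζ, hζ, h_box, rfl⟩ := H.exists_levelCurve_eq (by simp) (by simp) (by simp) ht hx
  obtain ⟨w, hw, hw_eq⟩ := H.bijOn_domain.surjOn ⟨h_box, hζ.1.le⟩
  have hw' : w = (levelCurve h O ζ t, t) :=
    H.bijOn.injOn (closure_mono inter_subset_right hw) (H.mk_levelCurve_mem h_box)
      (hw_eq.trans (H.apply_mk_levelCurve h_box).symm)
  exact hw' ▸ closure_mono inter_subset_left hw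

variable {S' O' : Set (ℝ × ℝ)} {α' β' : ℝ} {h' : ℝ × ℝ → ℝ × ℝ}

lemma disjoint_uIoo_timeSlice (H : IsLateralChart Q S O α β h) (hQ : IsOpen Q) (ht : t ∈ Ioo α β) :
    Disjoint (uIoo (levelCurve h O 0 t) (levelCurve h O (-1) t)) (timeSlice Q t) := by
  rw [uIoo_comm]
  exact disjoint_left.2 fun x hx hxQ =>
    disjoint_left.1 (H.disjoint_outerStrip hQ) (show (x, t) ∈ _ from ⟨ht, hx⟩) hxQ

lemma uIoo_inter_timeSlice_nonempty (H : IsLateralChart Q S O α β h) (hQ : IsOpen Q)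
    (ht : t ∈ Ioo α β) (h_frontier : levelCurve h O 0 t ∈ frontier (timeSlice Q t)) :
    (uIoo (levelCurve h O 0 t) (levelCurve h O 1 t) ∩ timeSlice Q t).Nonempty := by
  obtain ⟨y, hy, hyQ⟩ := mem_closure_iff.1 (frontier_subset_closure h_frontier) _ isOpen_Ioo
    (H.levelCurve_zero_mem_uIoo ht)
  refine ⟨y, mem_uIoo_of_notMem (H.levelCurve_zero_mem_uIoo ht) hy ?_ fun hy' => ?_, hyQ⟩
  · rintro rfl
    exact ((isOpen_timeSlice hQ t).frontier_eq ▸ h_frontier).2 hyQ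
  · rw [uIoo_comm] at hy'
    exact disjoint_left.1 (H.disjoint_uIoo_timeSlice hQ ht) hy' hyQ

lemma levelCurve_zero_notMem_uIoo (H : IsLateralChart Q S O α β h)
    (H' : IsLateralChart Q S' O' α' β' h') (hQ : IsOpen Q) (ht : t ∈ Ioo α β)
    (ht' : t ∈ Ioo α' β') :
    levelCurve h' O' 0 t ∉ uIoo (levelCurve h O 0 t) (levelCurve h O 1 t) := fun h_mem => by
  have h_ne : levelCurve h' O' (-1) t ≠ levelCurve h' O' 0 t :=
    (H'.injOn_levelCurve (ht'.1.trans ht'.2) (Ioo_subset_Icc_self ht')).ne (by simp) (by simp)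
      (by simp)
  have h_closure : levelCurve h' O' 0 t ∈
      closure (uIoo (levelCurve h' O' (-1) t) (levelCurve h' O' 0 t)) :=
    closure_uIoo h_ne ▸ right_mem_uIcc
  obtain ⟨y, hy, hy'⟩ := mem_closure_iff.1 h_closure _ isOpen_Ioo h_mem
  obtain ⟨z, hz, hzQ⟩ := mem_closure_iff.1 (H.mk_mem_closure_of_mem_uIoo ht hy) _
    H'.isOpen_outerStrip ⟨ht', hy'⟩
  exact disjoint_left.1 (H'.disjoint_outerStrip hQ) hz hzQ

end IsLateralChart

/-- Every boundary point of `A` is the end point of an interval of length `δ` inside `A` and of an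
interval of length `δ` outside `A`. -/
structure HasSeparatedBoundary (δ : ℝ) (A : Set ℝ) : Prop where
  exists_inner : ∀ x ∈ frontier A, ∃ d, δ ≤ |d - x| ∧ uIoo x d ⊆ A
  exists_outer : ∀ x ∈ frontier A, ∃ e, δ ≤ |e - x| ∧ Disjoint (uIoo x e) A

/-- What the analysis uses of the lateral charts: off a finite set `F` of times the time slices
have uniformly separated boundaries, and the lateral boundary lies on finitely many Lipschitz
curves. -/
structure HasLateralCurves (Q : Set (ℝ × ℝ)) (C : ℝ≥0) (δ : ℝ) (F : Set ℝ) {N : ℕ} (K : ℝ≥0)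
    (c : Fin N → ℝ → ℝ) : Prop where
  isOpen : IsOpen Q
  isBounded : Bornology.IsBounded Q
  volume_le : ∀ t, volume (timeSlice Q t) ≤ C
  pos : 0 < δ
  finite : F.Finite
  separated : ∀ t ∉ F, HasSeparatedBoundary δ (timeSlice Q t)
  lipschitz : ∀ i, LipschitzWith K (c i)
  mem_graph : ∀ z ∈ lateralFrontier Q, ∃ i, c i z.2 = z.1

section Charts

variable {Q : Set (ℝ × ℝ)} {N : ℕ} {O : Fin N → Set (ℝ × ℝ)} {α β : Fin N → ℝ}
  {h : Fin N → ℝ × ℝ → ℝ × ℝ}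

lemma hasSeparatedBoundary_timeSlice {t δ : ℝ} (hQ : IsOpen Q)
    (H : ∀ i, IsLateralChart Q (lateralFrontier Q) (O i) (α i) (β i) (h i))
    (h_cover : ∀ x ∈ frontier (timeSlice Q t),
      ∃ i, t ∈ Ioo (α i) (β i) ∧ levelCurve (h i) (O i) 0 t = x)
    (h_inner : ∀ i, t ∈ Ioo (α i) (β i) →
      δ ≤ |levelCurve (h i) (O i) 1 t - levelCurve (h i) (O i) 0 t|)
    (h_outer : ∀ i, t ∈ Ioo (α i) (β i) →
      δ ≤ |levelCurve (h i) (O i) (-1) t - levelCurve (h i) (O i) 0 t|) :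
    HasSeparatedBoundary δ (timeSlice Q t) where
  exists_inner x hx := by
    obtain ⟨i, hi, rfl⟩ := h_cover x hx
    refine ⟨_, h_inner i hi, ?_⟩
    by_contra h_sub
    obtain ⟨y, hy, hy_frontier⟩ := exists_mem_inter_frontier_of_isPreconnected isPreconnected_uIoo
      ((H i).uIoo_inter_timeSlice_nonempty hQ hi hx) h_sub
    obtain ⟨j, hj, rfl⟩ := h_cover y hy_frontier
    exact (H i).levelCurve_zero_notMem_uIoo (H j) hQ hi hj hy
  exists_outer x hx := by
    obtain ⟨i, hi, rfl⟩ := h_cover x hx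
    exact ⟨_, h_outer i hi, (H i).disjoint_uIoo_timeSlice hQ hi⟩

lemma exists_levelCurve_gap (H : ∀ i, IsLateralChart Q (lateralFrontier Q) (O i) (α i) (β i) (h i))
    {ξ η : ℝ} (hξ : ξ ∈ Icc (-1) 1) (hη : η ∈ Icc (-1) 1) (hne : ξ ≠ η) :
    ∃ δ > 0, ∀ i, ∀ t ∈ Ioo (α i) (β i),
      δ ≤ |levelCurve (h i) (O i) ξ t - levelCurve (h i) (O i) η t| := by
  have h_each (i : Fin N) : ∀ᶠ δ in 𝓝[>] (0 : ℝ), ∀ t ∈ Ioo (α i) (β i),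
      δ ≤ |levelCurve (h i) (O i) ξ t - levelCurve (h i) (O i) η t| := by
    rcases le_or_gt (β i) (α i) with hle | hlt
    · simp [Ioo_eq_empty_of_le hle]
    obtain ⟨δ, hδ, h_gap⟩ := (H i).exists_le_abs_levelCurve_sub hlt hξ hη hne
    filter_upwards [Ioo_mem_nhdsGT hδ] with ε hε t ht
    exact hε.2.le.trans (h_gap t (Ioo_subset_Icc_self ht))
  obtain ⟨δ, h_gap, hδ⟩ := ((eventually_all.2 h_each).and self_mem_nhdsWithin).exists
  exact ⟨δ, hδ, h_gap⟩

lemma exists_lipschitzWith_eq_fst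
    (H : ∀ i, IsLateralChart Q (lateralFrontier Q) (O i) (α i) (β i) (h i)) :
    ∃ (K : ℝ≥0) (c : Fin N → ℝ → ℝ), (∀ i, LipschitzWith K (c i)) ∧
      ∀ i, ∀ z ∈ lateralFrontier Q ∩ O i, c i z.2 = z.1 := by
  have h_each (i : Fin N) : ∃ (K : ℝ≥0) (c : ℝ → ℝ), LipschitzWith K c ∧
      ∀ z ∈ lateralFrontier Q ∩ O i, c z.2 = z.1 := by
    rcases (O i).eq_empty_or_nonempty with h_empty | ⟨z, hz⟩
    · exact ⟨0, 0, LipschitzWith.const 0, by simp [h_empty]⟩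
    obtain ⟨K, hK⟩ :=
      (H i).exists_lipschitzOnWith_levelCurve ((H i).lt_of_mem hz) (ξ := 0) (by simp)
    obtain ⟨c, hc, h_eq⟩ := hK.extend_real
    exact ⟨K, c, hc, fun z hz =>
      (h_eq ((H i).strip z hz.2)).symm.trans ((H i).levelCurve_zero_of_mem hz)⟩
  choose K c hc h_eq using h_each
  exact ⟨Finset.univ.sup K, c, fun i => (hc i).weaken (Finset.le_sup (Finset.mem_univ i)), h_eq⟩

end Charts

theorem exists_hasLateralCurves {Q : Set (ℝ × ℝ)} {C : ℝ≥0} (hQ : IsOpen Q)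
    (h_bounded : ∀ t, Bornology.IsBounded (timeSlice Q t))
    (h_volume : ∀ t, volume (timeSlice Q t) ≤ C)
    (h_charts : HasLateralCharts Q (lateralFrontier Q)) :
    ∃ (δ : ℝ) (F : Set ℝ) (N : ℕ) (K : ℝ≥0) (c : Fin N → ℝ → ℝ),
      HasLateralCurves Q C δ F K c := by
  obtain ⟨N, O, α, β, h, ⟨V, -, h_subV, hVO⟩, H⟩ := h_charts
  have h_cover : ∀ z ∈ lateralFrontier Q, ∃ i, z ∈ O i := fun z hz =>
    mem_iUnion.1 (hVO (h_subV hz))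
  obtain ⟨δ, hδ, h_inner⟩ := exists_levelCurve_gap H (ξ := 1) (η := 0) (by simp) (by simp) (by simp)
  obtain ⟨δ', hδ', h_outer⟩ :=
    exists_levelCurve_gap H (ξ := -1) (η := 0) (by simp) (by simp) (by simp)
  obtain ⟨K, c, hc, h_graph⟩ := exists_lipschitzWith_eq_fst H
  refine ⟨min δ δ', range α ∪ range β, N, K, c, hQ,
    isBounded_of_isBounded_lateralFrontier hQ h_bounded
      ((Bornology.isBounded_iUnion.2 fun i => (H i).isBounded).subset (h_subV.trans hVO)),
    h_volume, lt_min hδ hδ', (finite_range α).union (finite_range β), fun t ht => ?_, hc,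
    fun z hz => (h_cover z hz).imp fun i hi => h_graph i z ⟨hz, hi⟩⟩
  refine hasSeparatedBoundary_timeSlice hQ H (fun x hx => ?_)
    (fun i hi => (min_le_left _ _).trans (h_inner i t hi))
    (fun i hi => (min_le_right _ _).trans (h_outer i t hi))
  obtain ⟨i, hi⟩ := h_cover (x, t) hx
  have h_strip := (H i).strip _ hi
  exact ⟨i, ⟨lt_of_le_of_ne h_strip.1 fun h_eq => ht (Or.inl ⟨i, h_eq⟩),
    lt_of_le_of_ne h_strip.2 fun h_eq => ht (Or.inr ⟨i, h_eq.symm⟩)⟩,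
    (H i).levelCurve_zero_of_mem (z := (x, t)) ⟨hx, hi⟩⟩

lemma lipschitzWith_toLp_graph {K : ℝ≥0} {c : ℝ → ℝ} (hc : LipschitzWith K c) :
    LipschitzWith (K + 1) fun t : ℝ => WithLp.toLp 2 (c t, t) := by
  refine LipschitzWith.of_dist_le_mul fun s t => ?_
  rw [WithLp.prod_dist_eq_of_L2]
  refine Real.sqrt_le_iff.2 ⟨by positivity, ?_⟩
  change dist (c s) (c t) ^ 2 + dist s t ^ 2 ≤ _
  push_cast
  nlinarith [pow_le_pow_left₀ dist_nonneg (hc.dist_le_mul s t) 2,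
    mul_nonneg K.coe_nonneg (sq_nonneg (dist s t))]

lemma lipschitzWith_snd_ofLp : LipschitzWith 1 fun w : WithLp 2 (ℝ × ℝ) => (WithLp.ofLp w).2 := by
  refine LipschitzWith.of_dist_le_mul fun v w => ?_
  rw [WithLp.prod_dist_eq_of_L2, NNReal.coe_one, one_mul]
  exact Real.le_sqrt_of_sq_le (le_add_of_nonneg_left (sq_nonneg _))

lemma arcLength_apply {S E : Set (ℝ × ℝ)} (hS : MeasurableSet S) (hE : MeasurableSet E) :
    arcLength S E =
      (Measure.hausdorffMeasure 1 : Measure (WithLp 2 (ℝ × ℝ))) (WithLp.ofLp ⁻¹' (E ∩ S)) := by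
  rw [arcLength, Measure.restrict_apply hE,
    Measure.map_apply (WithLp.prod_continuous_ofLp 2 ℝ ℝ).measurable (hE.inter hS)]

lemma volume_image_snd_le_arcLength {S E : Set (ℝ × ℝ)} (hS : MeasurableSet S)
    (hE : MeasurableSet E) (hES : E ⊆ S) : volume (Prod.snd '' E) ≤ arcLength S E := by
  have h_image : Prod.snd '' E =
      (fun w : WithLp 2 (ℝ × ℝ) => (WithLp.ofLp w).2) '' (WithLp.ofLp ⁻¹' E) := by
    change _ = (Prod.snd ∘ WithLp.ofLp) '' _
    rw [image_comp, image_preimage_eq _ (WithLp.ofLp_surjective 2)]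
  rw [arcLength_apply hS hE, inter_eq_left.2 hES, h_image, ← hausdorffMeasure_real]
  simpa using lipschitzWith_snd_ofLp.hausdorffMeasure_image_le zero_le_one (preimage WithLp.ofLp E)

/-- The times at which the `i`-th graph meets `S` at a point which is on no earlier graph. They
select one graph through each point of `S`. -/
def firstGraphTimes (S : Set (ℝ × ℝ)) {N : ℕ} (c : Fin N → ℝ → ℝ) (i : Fin N) : Set ℝ :=
  {t | (c i t, t) ∈ S ∧ ∀ j < i, c j t ≠ c i t}

/-- The measure on a union `S` of pieces of graphs `x = c i t` that weighs each of them by the time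
it takes; for Lipschitz graphs it is comparable to arc length. -/
noncomputable def graphMeasure (S : Set (ℝ × ℝ)) {N : ℕ} (c : Fin N → ℝ → ℝ) : Measure (ℝ × ℝ) :=
  ∑ i, (volume.restrict (firstGraphTimes S c i)).map fun t => (c i t, t)

section Graphs

variable {S : Set (ℝ × ℝ)} {N : ℕ} {c : Fin N → ℝ → ℝ}

lemma exists_mem_firstGraphTimes (hSc : ∀ z ∈ S, ∃ i, c i z.2 = z.1) {z : ℝ × ℝ} (hz : z ∈ S) :
    ∃ i, c i z.2 = z.1 ∧ z.2 ∈ firstGraphTimes S c i := by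
  obtain ⟨i, hi, h_min⟩ := wellFounded_lt.has_min {i | c i z.2 = z.1} (hSc z hz)
  rw [mem_ofPred_eq] at hi
  exact ⟨i, hi, hi.symm ▸ hz, fun j hj h_eq => h_min j (h_eq.trans hi) hj⟩

lemma measurableSet_firstGraphTimes (hS : MeasurableSet S) (hc : ∀ i, Continuous (c i))
    (i : Fin N) : MeasurableSet (firstGraphTimes S c i) := by
  have h_graph : Measurable fun t => (c i t, t) := ((hc i).prodMk continuous_id).measurable
  refine (h_graph hS).inter (?_ : MeasurableSet {t | ∀ j < i, c j t ≠ c i t})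
  simp only [ofPred_forall]
  exact MeasurableSet.iInter fun j => MeasurableSet.iInter fun _ =>
    (isOpen_ne_fun (hc j) (hc i)).measurableSet

lemma graphMeasure_apply (hc : ∀ i, Continuous (c i)) {E : Set (ℝ × ℝ)} (hE : MeasurableSet E) :
    graphMeasure S c E = ∑ i, volume ({t | (c i t, t) ∈ E} ∩ firstGraphTimes S c i) := by
  rw [graphMeasure, Measure.finsetSum_apply]
  refine Finset.sum_congr rfl fun i _ => ?_
  have h_graph : Measurable fun t => (c i t, t) := ((hc i).prodMk continuous_id).measurable
  rw [Measure.map_apply h_graph hE, Measure.restrict_apply (h_graph hE)]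
  rfl

lemma lintegral_graphMeasure (hc : ∀ i, Continuous (c i)) {ψ : ℝ × ℝ → ℝ≥0∞}
    (hψ : Measurable ψ) :
    ∫⁻ z, ψ z ∂graphMeasure S c = ∑ i, ∫⁻ t in firstGraphTimes S c i, ψ (c i t, t) := by
  rw [graphMeasure, lintegral_finsetSum_measure]
  exact Finset.sum_congr rfl fun i _ =>
    lintegral_map hψ ((hc i).prodMk continuous_id).measurable

lemma arcLength_le_smul_graphMeasure (hS : MeasurableSet S) {K : ℝ≥0}
    (hc : ∀ i, LipschitzWith K (c i)) (hSc : ∀ z ∈ S, ∃ i, c i z.2 = z.1) :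
    arcLength S ≤ (K + 1) • graphMeasure S c := by
  refine Measure.le_iff.2 fun E hE => ?_
  have h_cover : WithLp.ofLp ⁻¹' (E ∩ S) ⊆ ⋃ i, (fun t => WithLp.toLp 2 (c i t, t)) ''
      ({t | (c i t, t) ∈ E} ∩ firstGraphTimes S c i) := fun w hw => by
    obtain ⟨i, h_eq, hi⟩ := exists_mem_firstGraphTimes hSc hw.2
    have h_point : (c i (WithLp.ofLp w).2, (WithLp.ofLp w).2) = WithLp.ofLp w := Prod.ext h_eq rfl
    exact mem_iUnion.2 ⟨i, (WithLp.ofLp w).2, ⟨h_point.symm ▸ hw.1, hi⟩,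
      congrArg (WithLp.toLp 2) h_point⟩
  rw [arcLength_apply hS hE, Measure.smul_apply, ENNReal.smul_def, smul_eq_mul,
    graphMeasure_apply (fun i => (hc i).continuous) hE, Finset.mul_sum]
  refine (measure_mono h_cover).trans ((measure_iUnion_fintype_le _ _).trans
    (Finset.sum_le_sum fun i _ => ?_))
  simpa [hausdorffMeasure_real] using
    (lipschitzWith_toLp_graph (hc i)).hausdorffMeasure_image_le zero_le_one
      ({t | (c i t, t) ∈ E} ∩ firstGraphTimes S c i)

lemma graphMeasure_le_arcLength (hS : MeasurableSet S) (hc : ∀ i, Continuous (c i)) :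
    graphMeasure S c ≤ arcLength S := by
  refine Measure.le_iff.2 fun E hE => ?_
  let piece (i : Fin N) : Set (ℝ × ℝ) :=
    (E ∩ S) ∩ ({z | z.1 = c i z.2} ∩ Prod.snd ⁻¹' firstGraphTimes S c i)
  have h_meas (i : Fin N) : MeasurableSet (piece i) := (hE.inter hS).inter
    ((isClosed_eq continuous_fst ((hc i).comp continuous_snd)).measurableSet.inter
      (measurable_snd (measurableSet_firstGraphTimes hS hc i)))
  have h_disj : Pairwise (Function.onFun Disjoint piece) := (pairwise_disjoint_on _).2
    fun i j hij => disjoint_left.2 fun z hi hj =>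
      hj.2.2.2 i hij (hi.2.1.symm.trans hj.2.1)
  rw [graphMeasure_apply hc hE]
  calc ∑ i, volume ({t | (c i t, t) ∈ E} ∩ firstGraphTimes S c i)
      ≤ ∑ i, arcLength S (piece i) := Finset.sum_le_sum fun i _ =>
        (measure_mono fun t ht => mem_image_of_mem Prod.snd
          (show (c i t, t) ∈ piece i from ⟨⟨ht.1, ht.2.1⟩, rfl, ht.2⟩)).trans
          (volume_image_snd_le_arcLength hS (h_meas i) fun z hz => hz.1.2)
    _ = arcLength S (⋃ i, piece i) := by rw [measure_iUnion h_disj h_meas, tsum_fintype]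
    _ ≤ arcLength S E := measure_mono (iUnion_subset fun i z hz => hz.1.1)

end Graphs

section OneDimensional

variable {A : Set ℝ} {p q : ℝ → ℝ} {x y : ℝ}

lemma enorm_add_sq_le {E : Type*} [SeminormedAddGroup E] (a b : E) :
    ‖a + b‖ₑ ^ 2 ≤ 2 * ‖a‖ₑ ^ 2 + 2 * ‖b‖ₑ ^ 2 := by
  simp only [← ofReal_norm, ← ENNReal.ofReal_pow (norm_nonneg _)]
  rw [← mul_add, ← ENNReal.ofReal_add (by positivity) (by positivity),
    ← ENNReal.ofReal_ofNat 2, ← ENNReal.ofReal_mul zero_le_two]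
  exact ENNReal.ofReal_le_ofReal
    ((pow_le_pow_left₀ (norm_nonneg _) (norm_add_le a b) 2).trans add_sq_le)

lemma sq_lintegral_le {α : Type*} [MeasurableSpace α] (μ : Measure α) {f : α → ℝ≥0∞}
    (hf : AEMeasurable f μ) : (∫⁻ x, f x ∂μ) ^ 2 ≤ μ univ * ∫⁻ x, f x ^ 2 ∂μ := by
  have h := ENNReal.lintegral_mul_le_Lp_mul_Lq μ Real.HolderConjugate.two_two
    (aemeasurable_const (b := (1 : ℝ≥0∞))) hf
  simp only [Pi.mul_apply, one_mul, ENNReal.one_rpow, lintegral_one] at h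
  simp only [ENNReal.rpow_two] at h
  calc (∫⁻ x, f x ∂μ) ^ 2
      ≤ (μ univ ^ (1 / 2 : ℝ) * (∫⁻ x, f x ^ 2 ∂μ) ^ (1 / 2 : ℝ)) ^ 2 := by gcongr
    _ = μ univ * ∫⁻ x, f x ^ 2 ∂μ := by
      rw [mul_pow, ← ENNReal.rpow_mul_natCast, ← ENNReal.rpow_mul_natCast]
      norm_num

lemma uIcc_subset_closure_of_uIoo_subset (hxy : x ≠ y) (h : uIoo x y ⊆ A) :
    uIcc x y ⊆ closure A := by
  rw [← closure_uIoo hxy]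
  exact closure_mono h

lemma enorm_sub_le_setLIntegral_deriv (hp : ContinuousOn p (closure A)) (hq : Measurable q)
    (hd : ∀ s ∈ A, HasDerivAt p (q s) s) (h : uIoo x y ⊆ A) :
    ‖p y - p x‖ₑ ≤ ∫⁻ s in A, ‖q s‖ₑ := by
  rcases eq_or_ne x y with rfl | hxy
  · simp
  by_cases h_top : ∫⁻ s in A, ‖q s‖ₑ = ⊤
  · exact h_top ▸ le_top
  have h_int : IntegrableOn q (uIoc x y) :=
    (integrableOn_Ioc_iff_integrableOn_Ioo).2
      (IntegrableOn.mono_set ⟨hq.aestronglyMeasurable, lt_top_iff_ne_top.2 h_top⟩ h)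
  have h_ftc : ∫ s in x..y, q s = p y - p x :=
    intervalIntegral.integral_eq_sub_of_hasDeriv_right
      (hp.mono (uIcc_subset_closure_of_uIoo_subset hxy h))
      (fun s hs => (hd s (h hs)).hasDerivWithinAt) (intervalIntegrable_iff.2 h_int)
  calc ‖p y - p x‖ₑ = ‖∫ s in uIoo x y, q s‖ₑ := by
        rw [← h_ftc, enorm_eq_iff_norm_eq, intervalIntegral.norm_intervalIntegral_eq]
        exact congrArg norm integral_Ioc_eq_integral_Ioo
    _ ≤ ∫⁻ s in uIoo x y, ‖q s‖ₑ := enorm_integral_le_lintegral_enorm _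
    _ ≤ ∫⁻ s in A, ‖q s‖ₑ := lintegral_mono_set h

lemma enorm_sq_le_of_uIoo_subset (hp : ContinuousOn p (closure A)) (hq : Measurable q)
    (hd : ∀ s ∈ A, HasDerivAt p (q s) s) (h : uIoo x y ⊆ A) :
    ‖p y‖ₑ ^ 2 ≤ 2 * ‖p x‖ₑ ^ 2 + 2 * (volume A * ∫⁻ s in A, ‖q s‖ₑ ^ 2) := by
  have h_sq := sq_lintegral_le (volume.restrict A) (f := fun s => ‖q s‖ₑ) hq.enorm.aemeasurable
  rw [Measure.restrict_apply_univ] at h_sq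
  calc ‖p y‖ₑ ^ 2 = ‖p x + (p y - p x)‖ₑ ^ 2 := by rw [add_sub_cancel]
    _ ≤ 2 * ‖p x‖ₑ ^ 2 + 2 * ‖p y - p x‖ₑ ^ 2 := enorm_add_sq_le _ _
    _ ≤ 2 * ‖p x‖ₑ ^ 2 + 2 * (∫⁻ s in A, ‖q s‖ₑ) ^ 2 := by
      gcongr; exact enorm_sub_le_setLIntegral_deriv hp hq hd h
    _ ≤ 2 * ‖p x‖ₑ ^ 2 + 2 * (volume A * ∫⁻ s in A, ‖q s‖ₑ ^ 2) := by gcongr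

lemma setLIntegral_enorm_sq_le_of_frontier (hA : IsOpen A) (hb : BddBelow A)
    (hp : ContinuousOn p (closure A)) (hq : Measurable q)
    (hd : ∀ s ∈ A, HasDerivAt p (q s) s) {D : ℝ≥0∞} (hD : ∀ x ∈ frontier A, ‖p x‖ₑ ^ 2 ≤ D) :
    ∫⁻ s in A, ‖p s‖ₑ ^ 2 ≤
      2 * (volume A * D) + 2 * (volume A ^ 2 * ∫⁻ s in A, ‖q s‖ₑ ^ 2) := by
  calc ∫⁻ s in A, ‖p s‖ₑ ^ 2
      ≤ ∫⁻ _ in A, (2 * D + 2 * (volume A * ∫⁻ s in A, ‖q s‖ₑ ^ 2)) := by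
        refine setLIntegral_mono' hA.measurableSet fun y hy => ?_
        obtain ⟨x, hx, hxy, h_sub⟩ := exists_mem_frontier_Ioc_subset hA hb hy
        rw [← uIoc_of_le hxy.le] at h_sub
        grw [enorm_sq_le_of_uIoo_subset hp hq hd (Ioo_subset_Ioc_self.trans h_sub), hD x hx]
    _ = 2 * (volume A * D) + 2 * (volume A ^ 2 * ∫⁻ s in A, ‖q s‖ₑ ^ 2) := by
        rw [setLIntegral_const]
        ring

lemma HasSeparatedBoundary.ofReal_mul_enorm_sq_le {δ : ℝ} (hA : HasSeparatedBoundary δ A)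
    (hp : ContinuousOn p (closure A)) (hq : Measurable q)
    (hd : ∀ s ∈ A, HasDerivAt p (q s) s) (hx : x ∈ frontier A) :
    ENNReal.ofReal δ * ‖p x‖ₑ ^ 2 ≤
      2 * (∫⁻ s in A, ‖p s‖ₑ ^ 2) + 2 * (volume A ^ 2 * ∫⁻ s in A, ‖q s‖ₑ ^ 2) := by
  obtain ⟨d, hd_le, h_sub⟩ := hA.exists_inner x hx
  have h_sub_of_mem (y : ℝ) (hy : y ∈ uIoo x d) : uIoo y x ⊆ A := fun s hs => h_sub <| by
    rw [uIoo_comm] at hs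
    exact ⟨(le_inf inf_le_left hy.1.le).trans_lt hs.1, hs.2.trans_le (sup_le le_sup_left hy.2.le)⟩
  calc ENNReal.ofReal δ * ‖p x‖ₑ ^ 2 ≤ volume (uIoo x d) * ‖p x‖ₑ ^ 2 := by
        rw [Real.volume_uIoo]
        gcongr
    _ = ∫⁻ _ in uIoo x d, ‖p x‖ₑ ^ 2 := by rw [setLIntegral_const, mul_comm]
    _ ≤ ∫⁻ y in uIoo x d, (2 * ‖p y‖ₑ ^ 2 + 2 * (volume A * ∫⁻ s in A, ‖q s‖ₑ ^ 2)) :=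
        setLIntegral_mono' measurableSet_Ioo fun y hy =>
          enorm_sq_le_of_uIoo_subset hp hq hd (h_sub_of_mem y hy)
    _ ≤ ∫⁻ y in A, (2 * ‖p y‖ₑ ^ 2 + 2 * (volume A * ∫⁻ s in A, ‖q s‖ₑ ^ 2)) :=
        lintegral_mono_set h_sub
    _ = 2 * (∫⁻ s in A, ‖p s‖ₑ ^ 2) + 2 * (volume A ^ 2 * ∫⁻ s in A, ‖q s‖ₑ ^ 2) := by
        rw [lintegral_add_right _ measurable_const, lintegral_const_mul' _ _ (by simp),
          setLIntegral_const]
        ring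

end OneDimensional

section Slicing

variable {Q : Set (ℝ × ℝ)} {ψ : ℝ × ℝ → ℝ≥0∞}

lemma setLIntegral_eq_lintegral_timeSlice (hQ : MeasurableSet Q) (hψ : Measurable ψ) :
    ∫⁻ z in Q, ψ z = ∫⁻ t, ∫⁻ x in timeSlice Q t, ψ (x, t) := by
  rw [← lintegral_indicator hQ, Measure.volume_eq_prod,
    lintegral_prod_symm _ (hψ.indicator hQ).aemeasurable]
  refine lintegral_congr fun t => ?_
  rw [← lintegral_indicator (measurableSet_timeSlice hQ t)]
  rfl

lemma measurable_lintegral_timeSlice (hQ : MeasurableSet Q) (hψ : Measurable ψ) :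
    Measurable fun t => ∫⁻ x in timeSlice Q t, ψ (x, t) := by
  have h := (hψ.indicator hQ).lintegral_prod_left' (μ := (volume : Measure ℝ))
  refine (congrArg Measurable (funext fun t => ?_)).mp h
  rw [← lintegral_indicator (measurableSet_timeSlice hQ t)]
  rfl

lemma continuousOn_closure_timeSlice {φ : ℝ × ℝ → ℝ} (hφ : ContinuousOn φ (closure Q)) (t : ℝ) :
    ContinuousOn (fun x => φ (x, t)) (closure (timeSlice Q t)) :=
  hφ.comp (by fun_prop) fun _ hx => mk_mem_closure_of_mem_closure_timeSlice hx

end Slicing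

/-- `φ` is continuous up to the boundary of `Q` and has the classical space derivative `q` in `Q`.
Both functions are defined, and measurable, on the whole plane. -/
structure HasClassicalDx (Q : Set (ℝ × ℝ)) (φ q : ℝ × ℝ → ℝ) : Prop where
  measurable : Measurable φ
  measurable_dx : Measurable q
  continuousOn : ContinuousOn φ (closure Q)
  hasDerivAt : ∀ z ∈ Q, HasDerivAt (fun x => φ (x, z.2)) (q z) z.1

namespace HasLateralCurves

variable {Q : Set (ℝ × ℝ)} {C K : ℝ≥0} {δ : ℝ} {F : Set ℝ} {N : ℕ} {c : Fin N → ℝ → ℝ}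
  {φ q : ℝ × ℝ → ℝ}

lemma ae_hasSeparatedBoundary (H : HasLateralCurves Q C δ F K c) :
    ∀ᵐ t : ℝ, HasSeparatedBoundary δ (timeSlice Q t) :=
  (H.finite.countable.ae_notMem volume).mono H.separated

lemma ofReal_mul_enorm_sq_le (H : HasLateralCurves Q C δ F K c) (hφ : HasClassicalDx Q φ q) {t : ℝ}
    (ht : HasSeparatedBoundary δ (timeSlice Q t)) {x : ℝ} (hx : x ∈ frontier (timeSlice Q t)) :
    ENNReal.ofReal δ * ‖φ (x, t)‖ₑ ^ 2 ≤
      2 * (∫⁻ y in timeSlice Q t, ‖φ (y, t)‖ₑ ^ 2) +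
        2 * C ^ 2 * ∫⁻ y in timeSlice Q t, ‖q (y, t)‖ₑ ^ 2 := by
  have h_slice := ht.ofReal_mul_enorm_sq_le (continuousOn_closure_timeSlice hφ.continuousOn t)
    (hφ.measurable_dx.comp (by fun_prop : Measurable fun y : ℝ => (y, t)))
    (fun y hy => hφ.hasDerivAt (y, t) hy) hx
  grw [h_slice, H.volume_le t, mul_assoc]
  rfl

lemma ofReal_mul_lintegral_firstGraphTimes_le (H : HasLateralCurves Q C δ F K c)
    (hφ : HasClassicalDx Q φ q) (i : Fin N) :
    ENNReal.ofReal δ * ∫⁻ t in firstGraphTimes (lateralFrontier Q) c i, ‖φ (c i t, t)‖ₑ ^ 2 ≤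
      2 * (∫⁻ z in Q, ‖φ z‖ₑ ^ 2) + 2 * C ^ 2 * ∫⁻ z in Q, ‖q z‖ₑ ^ 2 := by
  have h_meas : MeasurableSet (firstGraphTimes (lateralFrontier Q) c i) :=
    measurableSet_firstGraphTimes (measurableSet_lateralFrontier H.isOpen)
      (fun j => (H.lipschitz j).continuous) i
  have hφ_sq : Measurable fun z => ‖φ z‖ₑ ^ 2 := hφ.measurable.enorm.pow_const 2
  have hq_sq : Measurable fun z => ‖q z‖ₑ ^ 2 := hφ.measurable_dx.enorm.pow_const 2
  have hQ := H.isOpen.measurableSet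
  rw [← lintegral_const_mul' _ _ ENNReal.ofReal_ne_top]
  calc ∫⁻ t in firstGraphTimes (lateralFrontier Q) c i, ENNReal.ofReal δ * ‖φ (c i t, t)‖ₑ ^ 2
      ≤ ∫⁻ t in firstGraphTimes (lateralFrontier Q) c i,
          (2 * (∫⁻ y in timeSlice Q t, ‖φ (y, t)‖ₑ ^ 2) +
            2 * C ^ 2 * ∫⁻ y in timeSlice Q t, ‖q (y, t)‖ₑ ^ 2) :=
        setLIntegral_mono_ae' h_meas (H.ae_hasSeparatedBoundary.mono fun t ht hti =>
          H.ofReal_mul_enorm_sq_le hφ ht hti.1)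
    _ ≤ ∫⁻ t, (2 * (∫⁻ y in timeSlice Q t, ‖φ (y, t)‖ₑ ^ 2) +
            2 * C ^ 2 * ∫⁻ y in timeSlice Q t, ‖q (y, t)‖ₑ ^ 2) := setLIntegral_le_lintegral _ _
    _ = 2 * (∫⁻ z in Q, ‖φ z‖ₑ ^ 2) + 2 * C ^ 2 * ∫⁻ z in Q, ‖q z‖ₑ ^ 2 := by
        rw [lintegral_add_left ((measurable_lintegral_timeSlice hQ hφ_sq).const_mul 2),
          lintegral_const_mul _ (measurable_lintegral_timeSlice hQ hφ_sq),
          lintegral_const_mul _ (measurable_lintegral_timeSlice hQ hq_sq),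
          setLIntegral_eq_lintegral_timeSlice hQ hφ_sq,
          setLIntegral_eq_lintegral_timeSlice hQ hq_sq]

lemma ofReal_mul_lintegral_arcLength_le (H : HasLateralCurves Q C δ F K c)
    (hφ : HasClassicalDx Q φ q) :
    ENNReal.ofReal δ * ∫⁻ z, ‖φ z‖ₑ ^ 2 ∂arcLength (lateralFrontier Q) ≤
      (K + 1) * (N * (2 * (∫⁻ z in Q, ‖φ z‖ₑ ^ 2) + 2 * C ^ 2 * ∫⁻ z in Q, ‖q z‖ₑ ^ 2)) := by
  have h_arc := lintegral_mono' (arcLength_le_smul_graphMeasure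
    (measurableSet_lateralFrontier H.isOpen) H.lipschitz H.mem_graph) (le_refl fun z => ‖φ z‖ₑ ^ 2)
  rw [lintegral_smul_measure, lintegral_graphMeasure (fun i => (H.lipschitz i).continuous)
    (hφ.measurable.enorm.pow_const 2), ENNReal.smul_def, smul_eq_mul] at h_arc
  grw [h_arc]
  rw [mul_left_comm, Finset.mul_sum]
  push_cast
  gcongr
  exact (Finset.sum_le_card_nsmul _ _ _ fun i _ =>
    H.ofReal_mul_lintegral_firstGraphTimes_le hφ i).trans_eq
    (by rw [Finset.card_univ, Fintype.card_fin, nsmul_eq_mul])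

theorem exists_lintegral_arcLength_le (H : HasLateralCurves Q C δ F K c) :
    ∃ M : ℝ≥0, ∀ φ q, HasClassicalDx Q φ q →
      ∫⁻ z, ‖φ z‖ₑ ^ 2 ∂arcLength (lateralFrontier Q) ≤
        M * ((∫⁻ z in Q, ‖φ z‖ₑ ^ 2) + ∫⁻ z in Q, ‖q z‖ₑ ^ 2) := by
  refine ⟨δ.toNNReal⁻¹ * ((K + 1) * (N * (2 + 2 * C ^ 2))), fun φ q hφ => ?_⟩
  have h_pos : δ.toNNReal ≠ 0 := (Real.toNNReal_pos.2 H.pos).ne'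
  have h_le : 2 * (∫⁻ z in Q, ‖φ z‖ₑ ^ 2) + 2 * C ^ 2 * ∫⁻ z in Q, ‖q z‖ₑ ^ 2 ≤
      (2 + 2 * C ^ 2) * ((∫⁻ z in Q, ‖φ z‖ₑ ^ 2) + ∫⁻ z in Q, ‖q z‖ₑ ^ 2) := by
    rw [mul_add]
    gcongr
    exacts [le_self_add, le_add_self]
  have h_arc := H.ofReal_mul_lintegral_arcLength_le hφ
  grw [h_le] at h_arc
  push_cast [ENNReal.coe_inv h_pos]
  rw [mul_assoc, ← ENNReal.mul_le_iff_le_inv (by simpa using h_pos) ENNReal.coe_ne_top]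
  simpa only [mul_assoc, ENNReal.ofReal] using h_arc

lemma setLIntegral_timeSlice_le (H : HasLateralCurves Q C δ F K c) (hφ : HasClassicalDx Q φ q)
    (t : ℝ) :
    ∫⁻ x in timeSlice Q t, ‖φ (x, t)‖ₑ ^ 2 ≤
      2 * (C * ∑ i, (firstGraphTimes (lateralFrontier Q) c i).indicator
        (fun s => ‖φ (c i s, s)‖ₑ ^ 2) t) +
      2 * (C ^ 2 * ∫⁻ x in timeSlice Q t, ‖q (x, t)‖ₑ ^ 2) := by
  have h_slice := setLIntegral_enorm_sq_le_of_frontier (isOpen_timeSlice H.isOpen t)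
    (isBounded_timeSlice H.isBounded t).bddBelow (continuousOn_closure_timeSlice hφ.continuousOn t)
    (hφ.measurable_dx.comp (by fun_prop : Measurable fun x : ℝ => (x, t)))
    (fun y hy => hφ.hasDerivAt (y, t) hy)
    (D := ∑ i, (firstGraphTimes (lateralFrontier Q) c i).indicator
      (fun s => ‖φ (c i s, s)‖ₑ ^ 2) t) fun x hx => ?_
  · grw [h_slice, H.volume_le t]
    rfl
  · obtain ⟨i, h_eq, hi⟩ := exists_mem_firstGraphTimes H.mem_graph
      (show (x, t) ∈ lateralFrontier Q from hx)
    refine le_trans (le_of_eq ?_) (Finset.single_le_sum (fun _ _ => zero_le) (Finset.mem_univ i))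
    rw [indicator_of_mem hi]
    exact congrArg (fun y => ‖φ (y, t)‖ₑ ^ 2) h_eq.symm

theorem lintegral_le_arcLength (H : HasLateralCurves Q C δ F K c) (hφ : HasClassicalDx Q φ q) :
    ∫⁻ z in Q, ‖φ z‖ₑ ^ 2 ≤
      2 * (C * ∫⁻ z, ‖φ z‖ₑ ^ 2 ∂arcLength (lateralFrontier Q)) +
        2 * (C ^ 2 * ∫⁻ z in Q, ‖q z‖ₑ ^ 2) := by
  have hS := measurableSet_lateralFrontier H.isOpen
  have hc (i : Fin N) := (H.lipschitz i).continuous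
  have hφ_sq : Measurable fun z => ‖φ z‖ₑ ^ 2 := hφ.measurable.enorm.pow_const 2
  have hq_sq : Measurable fun z => ‖q z‖ₑ ^ 2 := hφ.measurable_dx.enorm.pow_const 2
  have h_meas (i : Fin N) : Measurable ((firstGraphTimes (lateralFrontier Q) c i).indicator
      fun s => ‖φ (c i s, s)‖ₑ ^ 2) :=
    (hφ_sq.comp ((hc i).prodMk continuous_id).measurable).indicator
      (measurableSet_firstGraphTimes hS hc i)
  have h_sum : ∫⁻ t, ∑ i, (firstGraphTimes (lateralFrontier Q) c i).indicator
      (fun s => ‖φ (c i s, s)‖ₑ ^ 2) t ≤ ∫⁻ z, ‖φ z‖ₑ ^ 2 ∂arcLength (lateralFrontier Q) := by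
    rw [lintegral_finsetSum _ fun i _ => h_meas i]
    simp only [lintegral_indicator (measurableSet_firstGraphTimes hS hc _)]
    rw [← lintegral_graphMeasure hc hφ_sq]
    exact lintegral_mono' (graphMeasure_le_arcLength hS hc) le_rfl
  have h_dx := measurable_lintegral_timeSlice H.isOpen.measurableSet hq_sq
  rw [setLIntegral_eq_lintegral_timeSlice H.isOpen.measurableSet hφ_sq,
    setLIntegral_eq_lintegral_timeSlice H.isOpen.measurableSet hq_sq]
  grw [lintegral_mono (H.setLIntegral_timeSlice_le hφ), lintegral_add_right _
    ((h_dx.const_mul _).const_mul 2), lintegral_const_mul _ (by fun_prop),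
    lintegral_const_mul _ (by fun_prop), lintegral_const_mul _ (h_dx.const_mul _),
    lintegral_const_mul _ h_dx, h_sum]

end HasLateralCurves

section SpacePrimitive

variable {φ θ f : ℝ × ℝ → ℝ}

lemma hasDerivAt_fderiv_dx {z : ℝ × ℝ} (h : DifferentiableAt ℝ φ z) :
    HasDerivAt (fun x => φ (x, z.2)) (fderiv ℝ φ z (1, 0)) z.1 :=
  HasFDerivAt.comp_hasDerivAt z.1 (l := φ) (f := fun x => (x, z.2)) h.hasFDerivAt
    ((hasDerivAt_id z.1).prodMk (hasDerivAt_const z.1 z.2))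

lemma ae_ae_slice {p : ℝ × ℝ → Prop} (h : ∀ᵐ z, p z) : ∀ᵐ t : ℝ, ∀ᵐ x : ℝ, p (x, t) :=
  Measure.ae_ae_of_ae_prod (p := fun w : ℝ × ℝ => p w.swap)
    ((Measure.measurePreserving_swap (μ := (volume : Measure ℝ))
      (ν := (volume : Measure ℝ))).quasiMeasurePreserving.ae h)

lemma ae_integrable_slice (hf : Integrable f) : ∀ᵐ t : ℝ, Integrable fun x => f (x, t) :=
  Integrable.prod_left_ae (μ := (volume : Measure ℝ)) (ν := (volume : Measure ℝ)) hf

lemma hasCompactSupport_slice (hc : HasCompactSupport θ) (t : ℝ) :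
    HasCompactSupport fun x => θ (x, t) :=
  HasCompactSupport.intro (hc.isCompact.image continuous_fst) fun _ hx =>
    image_eq_zero_of_notMem_tsupport fun h => hx (mem_image_of_mem Prod.fst h)

lemma integrable_slice (hθ : Continuous θ) (hc : HasCompactSupport θ) (t : ℝ) :
    Integrable fun x => θ (x, t) :=
  (by fun_prop : Continuous fun x => θ (x, t)).integrable_of_hasCompactSupport
    (hasCompactSupport_slice hc t)

-- The primitive is the convolution of `θ` with the Heaviside function, with `t` as a parameter.
lemma contDiff_integral_Iic (hθ : ContDiff ℝ ∞ θ) (hc : HasCompactSupport θ) :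
    ContDiff ℝ ∞ fun z : ℝ × ℝ => ∫ y in Iic z.1, θ (y, z.2) := by
  have h_locInt : LocallyIntegrable ((Ici 0).indicator fun _ => 1 : ℝ → ℝ) :=
    (locallyIntegrable_const (1 : ℝ)).indicator measurableSet_Ici
  have h_conv := contDiffOn_convolution_right_with_param (𝕜 := ℝ) (n := (⊤ : ℕ∞)) (μ := volume)
    (ContinuousLinearMap.mul ℝ ℝ) (g := fun t x => θ (x, t)) (s := univ)
    (k := Prod.fst '' tsupport θ) isOpen_univ (hc.isCompact.image continuous_fst)
    (fun t x _ hx => image_eq_zero_of_notMem_tsupport fun h => hx ⟨(x, t), h, rfl⟩) h_locInt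
    (hθ.comp (contDiff_snd.prodMk contDiff_fst)).contDiffOn
  rw [univ_prod_univ, contDiffOn_univ] at h_conv
  have h_swap := h_conv.comp
    (contDiff_snd.prodMk contDiff_fst : ContDiff ℝ ∞ fun z : ℝ × ℝ => (z.2, z.1))
  refine (congrArg (ContDiff ℝ ∞) (funext fun z => ?_)).mp h_swap
  change ∫ s, (Ici 0).indicator (fun _ => 1) s * θ (z.1 - s, z.2) = _
  rw [← integral_sub_left_eq_self _ volume z.1, ← integral_indicator measurableSet_Iic]
  refine integral_congr_ae (ae_of_all _ fun y => ?_)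
  by_cases hy : y ≤ z.1
  · simp [hy]
  · simp [hy]

lemma hasDerivAt_integral_Iic {θ : ℝ → ℝ} (hθ : Continuous θ) (hi : Integrable θ) (x : ℝ) :
    HasDerivAt (fun x => ∫ y in Iic x, θ y) (θ x) x := by
  have h_split : (fun x => ∫ y in Iic x, θ y) =
      fun x => (∫ y in Iic 0, θ y) + ∫ y in 0..x, θ y := by
    funext x
    rw [← intervalIntegral.integral_Iic_sub_Iic hi.integrableOn hi.integrableOn, add_sub_cancel]
  rw [h_split]
  exact (hθ.integral_hasStrictDerivAt 0 x).hasDerivAt.const_add _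

lemma fderiv_integral_Iic_dx (hθ : ContDiff ℝ ∞ θ) (hc : HasCompactSupport θ) (z : ℝ × ℝ) :
    fderiv ℝ (fun z : ℝ × ℝ => ∫ y in Iic z.1, θ (y, z.2)) z (1, 0) = θ z :=
  (hasDerivAt_fderiv_dx (((contDiff_integral_Iic hθ hc).differentiable (by simp)) z)).unique
    (hasDerivAt_integral_Iic (hθ.continuous.comp (by fun_prop))
      (integrable_slice hθ.continuous hc z.2) z.1)

lemma integral_Ici_eq {f : ℝ → ℝ} (hf : Integrable f) (a x : ℝ) :
    ∫ y in Ici x, f y = (∫ y in Ici a, f y) - ∫ y in a..x, f y := by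
  rw [integral_Ici_eq_integral_Ioi, integral_Ici_eq_integral_Ioi,
    ← intervalIntegral.integral_Ioi_sub_Ioi' hf.integrableOn hf.integrableOn, sub_sub_cancel]

lemma continuous_integral_Ici {f : ℝ → ℝ} (hf : Integrable f) :
    Continuous fun x => ∫ y in Ici x, f y := by
  rw [funext (integral_Ici_eq hf 0)]
  exact continuous_const.sub
    (intervalIntegral.continuous_primitive (fun _ _ => hf.intervalIntegrable) 0)

lemma stronglyMeasurable_integral_Ici (hf : StronglyMeasurable f) :
    StronglyMeasurable fun z : ℝ × ℝ => ∫ x in Ici z.1, f (x, z.2) := by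
  simp only [← integral_indicator measurableSet_Ici]
  refine StronglyMeasurable.integral_prod_right
    (f := fun (z : ℝ × ℝ) x => (Ici z.1).indicator (fun x => f (x, z.2)) x) ?_
  exact ((hf.measurable.comp (by fun_prop : Measurable fun w : (ℝ × ℝ) × ℝ => (w.2, w.1.2)))
    |>.indicator (measurableSet_le (by fun_prop) (by fun_prop) :
      MeasurableSet {w : (ℝ × ℝ) × ℝ | w.1.1 ≤ w.2})).stronglyMeasurable

lemma locallyIntegrable_integral_Ici (hfm : StronglyMeasurable f) (hf : Integrable f) :
    LocallyIntegrable fun z : ℝ × ℝ => ∫ x in Ici z.1, f (x, z.2) := by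
  have h_norm : Integrable fun t : ℝ => ∫ x, ‖f (x, t)‖ := Integrable.integral_prod_right
    (μ := (volume : Measure ℝ)) (ν := (volume : Measure ℝ)) hf.norm
  have h_bound : ∀ᵐ z : ℝ × ℝ, ‖∫ x in Ici z.1, f (x, z.2)‖ ≤ ∫ x, ‖f (x, z.2)‖ := by
    filter_upwards [(Measure.quasiMeasurePreserving_snd (μ := (volume : Measure ℝ))
      (ν := (volume : Measure ℝ))).ae (ae_integrable_slice hf)] with z hz
    exact (norm_integral_le_integral_norm _).trans
      (setIntegral_le_integral hz.norm (ae_of_all _ fun x => norm_nonneg _))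
  refine locallyIntegrable_iff.2 fun B hB => ?_
  have h_finite : IsFiniteMeasure (volume.restrict (Prod.fst '' B)) :=
    isFiniteMeasure_restrict.2 (hB.image continuous_fst).measure_ne_top
  have h_dom : IntegrableOn (fun z : ℝ × ℝ => ∫ x, ‖f (x, z.2)‖) ((Prod.fst '' B) ×ˢ univ) := by
    rw [IntegrableOn, Measure.volume_eq_prod, ← Measure.prod_restrict, Measure.restrict_univ]
    exact h_norm.comp_snd _
  exact Integrable.mono' (h_dom.mono_set fun z hz => ⟨mem_image_of_mem _ hz, mem_univ _⟩)
    (stronglyMeasurable_integral_Ici hfm).aestronglyMeasurable (ae_restrict_of_ae h_bound)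

lemma exists_norm_integral_Iic_le (hθ : Continuous θ) (hc : HasCompactSupport θ) :
    ∃ D, ∀ z : ℝ × ℝ, ‖∫ y in Iic z.1, θ (y, z.2)‖ ≤ D := by
  obtain ⟨M, hM⟩ := hc.exists_bound_of_continuous hθ
  have h_cpt : IsCompact (Prod.fst '' tsupport θ) := hc.isCompact.image continuous_fst
  refine ⟨M * volume.real (Prod.fst '' tsupport θ), fun z => ?_⟩
  have h_zero (y : ℝ) (hy : y ∈ Iic z.1 \ (Prod.fst '' tsupport θ ∩ Iic z.1)) : θ (y, z.2) = 0 :=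
    image_eq_zero_of_notMem_tsupport fun h => hy.2 ⟨mem_image_of_mem Prod.fst h, hy.1⟩
  rw [setIntegral_eq_of_subset_of_forall_sdiff_eq_zero measurableSet_Iic inter_subset_right h_zero]
  refine (norm_setIntegral_le_of_norm_le_const
    ((measure_mono inter_subset_left).trans_lt h_cpt.measure_lt_top) fun y _ => hM _).trans ?_
  gcongr
  exacts [(norm_nonneg _).trans (hM 0), h_cpt.measure_ne_top, inter_subset_left]

lemma integral_mul_integral_Iic_eq {f θ : ℝ → ℝ} (hf : Integrable f) (hθ : Integrable θ) :
    ∫ x, f x * ∫ y in Iic x, θ y = ∫ y, θ y * ∫ x in Ici y, f x := by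
  have h_prod : Integrable (Function.uncurry fun x y => (Iic x).indicator (fun y => f x * θ y) y)
      ((volume : Measure ℝ).prod volume) :=
    (hf.mul_prod hθ).indicator
      (measurableSet_le measurable_snd measurable_fst : MeasurableSet {p : ℝ × ℝ | p.2 ≤ p.1})
  have h_swap := integral_integral_swap h_prod
  have h_indicator (x y : ℝ) : (Iic x).indicator (fun y => f x * θ y) y =
      (Ici y).indicator (fun x => θ y * f x) x := by
    simp only [indicator_apply, mem_Iic, mem_Ici, mul_comm]
  simp only [integral_indicator measurableSet_Iic] at h_swap
  simpa only [h_indicator, integral_indicator measurableSet_Ici, integral_const_mul] using h_swap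

lemma integral_mul_integral_Iic_slice_eq (hfm : StronglyMeasurable f) (hf : Integrable f)
    (hθ : ContDiff ℝ ∞ θ) (hc : HasCompactSupport θ) :
    ∫ z, f z * ∫ y in Iic z.1, θ (y, z.2) = ∫ z, θ z * ∫ x in Ici z.1, f (x, z.2) := by
  obtain ⟨D, hD⟩ := exists_norm_integral_Iic_le hθ.continuous hc
  have h_left : Integrable fun z : ℝ × ℝ => f z * ∫ y in Iic z.1, θ (y, z.2) :=
    hf.mul_bdd (contDiff_integral_Iic hθ hc).continuous.aestronglyMeasurable (ae_of_all _ hD)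
  have h_right : Integrable fun z : ℝ × ℝ => θ z * ∫ x in Ici z.1, f (x, z.2) :=
    (locallyIntegrable_integral_Ici hfm hf).integrable_smul_left_of_hasCompactSupport
      hθ.continuous hc
  rw [Measure.volume_eq_prod, integral_prod_symm _ h_left, integral_prod_symm _ h_right]
  exact integral_congr_ae ((ae_integrable_slice hf).mono fun t ht =>
    integral_mul_integral_Iic_eq ht (integrable_slice hθ.continuous hc t))

end SpacePrimitive

lemma exists_seq_cutoff {E : Type*} [NormedAddCommGroup E] [NormedSpace ℝ E]
    [FiniteDimensional ℝ E] {U : Set E} (hU : IsOpen U) :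
    ∃ χ : ℕ → E → ℝ, (∀ n, ContDiff ℝ ∞ (χ n)) ∧ (∀ n, tsupport (χ n) ⊆ U) ∧
      ∀ K ⊆ U, IsCompact K → ∃ n, ∀ x ∈ K, χ n =ᶠ[𝓝 x] 1 := by
  obtain ⟨f, h_supp, hf, h_range⟩ := hU.exists_contDiff_support_eq (n := ⊤)
  refine ⟨fun n x => Real.smoothTransition (n * f x - 1),
    fun n => Real.smoothTransition.contDiff.comp ((contDiff_const.mul hf).sub contDiff_const),
    fun n x hx => ?_, fun K hK hKc => ?_⟩
  · have h_closed : IsClosed {x | 1 ≤ n * f x} :=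
      isClosed_le continuous_const (continuous_const.mul hf.continuous)
    have h_one_le : 1 ≤ n * f x := closure_minimal (fun y hy => show 1 ≤ n * f y from
      le_of_not_gt fun h_lt => Function.mem_support.1 hy
        (Real.smoothTransition.zero_of_nonpos (by linarith))) h_closed hx
    rw [← h_supp]
    exact fun h_zero => absurd h_one_le (by simp [h_zero])
  · rcases K.eq_empty_or_nonempty with rfl | h_ne
    · exact ⟨0, by simp⟩
    obtain ⟨x₀, hx₀, h_min⟩ := hKc.exists_isMinOn h_ne hf.continuous.continuousOn
    have h_pos : 0 < f x₀ := ((h_range (mem_range_self x₀)).1).lt_of_ne'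
      (Function.mem_support.1 (h_supp ▸ hK hx₀))
    obtain ⟨n, hn⟩ := exists_nat_gt (2 / f x₀)
    rw [div_lt_iff₀ h_pos] at hn
    refine ⟨n, fun x hx => ?_⟩
    have h_lt : 2 < n * f x := hn.trans_le (by gcongr; exact h_min hx)
    have h_near : ∀ᶠ y in 𝓝 x, 2 < n * f y :=
      (continuous_const.mul hf.continuous).continuousAt.eventually (lt_mem_nhds h_lt)
    exact h_near.mono fun y hy => Real.smoothTransition.one_of_one_le (by linarith)

/-- On `U` the function `g` is the weak space derivative of `u`. Unlike in `IsWeakDx`, both are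
functions on the whole plane, integrable there, so that they can be restricted to time slices. -/
structure HasWeakDx (U : Set (ℝ × ℝ)) (u g : ℝ × ℝ → ℝ) : Prop where
  stronglyMeasurable : StronglyMeasurable u
  stronglyMeasurable_dx : StronglyMeasurable g
  integrable : Integrable u
  integrable_dx : Integrable g
  integral_mul_fderiv : ∀ φ : ℝ × ℝ → ℝ, ContDiff ℝ ∞ φ → HasCompactSupport φ → tsupport φ ⊆ U →
    ∫ z, u z * fderiv ℝ φ z (1, 0) = -∫ z, g z * φ z

namespace HasWeakDx

variable {U : Set (ℝ × ℝ)} {u g : ℝ × ℝ → ℝ}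

lemma mul_cutoff (H : HasWeakDx U u g) {χ : ℝ × ℝ → ℝ} (hχ : ContDiff ℝ ∞ χ)
    (hχc : HasCompactSupport χ) (hχU : tsupport χ ⊆ U) :
    HasWeakDx univ (fun z => u z * χ z) fun z => g z * χ z + u z * fderiv ℝ χ z (1, 0) := by
  have h_dχ : Continuous fun z => fderiv ℝ χ z (1, 0) := continuous_dx_test hχ
  have h_mul_integrable {v ψ : ℝ × ℝ → ℝ} (hv : Integrable v) (hψ : Continuous ψ)
      (hψc : HasCompactSupport ψ) : Integrable fun z => v z * ψ z :=
    hv.locallyIntegrable.integrable_smul_right_of_hasCompactSupport hψ hψc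
  have h_int := h_mul_integrable H.integrable hχ.continuous hχc
  have h_int_dx := (h_mul_integrable H.integrable_dx hχ.continuous hχc).add
    (h_mul_integrable H.integrable h_dχ (hχc.fderiv_apply ℝ _))
  refine ⟨H.stronglyMeasurable.mul hχ.continuous.stronglyMeasurable,
    (H.stronglyMeasurable_dx.mul hχ.continuous.stronglyMeasurable).add
      (H.stronglyMeasurable.mul h_dχ.stronglyMeasurable), h_int, h_int_dx, fun φ hφ hφc _ => ?_⟩
  have h_leibniz (z : ℝ × ℝ) : fderiv ℝ (fun z => χ z * φ z) z (1, 0) =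
      χ z * fderiv ℝ φ z (1, 0) + φ z * fderiv ℝ χ z (1, 0) := by
    rw [fderiv_fun_mul (hχ.differentiable (by simp) z) (hφ.differentiable (by simp) z)]
    rfl
  have h_test := H.integral_mul_fderiv _ (hχ.mul hφ) hχc.mul_right
    ((tsupport_mul_subset_left).trans hχU)
  have h_fderiv := h_mul_integrable h_int (continuous_dx_test hφ) (hφc.fderiv_apply ℝ (1, 0))
  have h_mul := h_mul_integrable (h_mul_integrable H.integrable h_dχ (hχc.fderiv_apply ℝ _))
    hφ.continuous hφc
  have h_mul_dx := h_mul_integrable (h_mul_integrable H.integrable_dx hχ.continuous hχc)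
    hφ.continuous hφc
  have h_split : (∫ z, u z * χ z * fderiv ℝ φ z (1, 0)) +
      ∫ z, u z * fderiv ℝ χ z (1, 0) * φ z = -∫ z, g z * χ z * φ z := by
    rw [← integral_add h_fderiv h_mul]
    simpa only [h_leibniz, mul_add, mul_assoc, mul_comm (φ _)] using h_test
  simp only [add_mul]
  rw [integral_add h_mul_dx h_mul]
  linarith

-- Test functions are `ηP` with `P` a primitive of an arbitrary `θ` in space and `η` a cutoff equal
-- to `1` near the supports.
lemma ae_eq_neg_integral_Ici (H : HasWeakDx univ u g) (hu : HasCompactSupport u)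
    (hg : HasCompactSupport g) : ∀ᵐ z : ℝ × ℝ, u z = -∫ x in Ici z.1, g (x, z.2) := by
  obtain ⟨r, hr, h_ball⟩ := (hu.isCompact.union hg.isCompact).isBounded.subset_ball_lt 0 0
  let η : ContDiffBump (0 : ℝ × ℝ) := ⟨r, r + 1, hr, by linarith⟩
  have h_one {z : ℝ × ℝ} (hz : z ∈ tsupport u ∪ tsupport g) : η =ᶠ[𝓝 z] 1 :=
    η.eventuallyEq_one_of_mem_ball (h_ball hz)
  have h_locInt := locallyIntegrable_integral_Ici H.stronglyMeasurable_dx H.integrable_dx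
  have h_ae := ae_eq_zero_of_integral_contDiff_smul_eq_zero
    (H.integrable.locallyIntegrable.add h_locInt) fun θ hθ hθc => ?_
  · filter_upwards [h_ae] with z hz
    exact eq_neg_of_add_eq_zero_left hz
  let P : ℝ × ℝ → ℝ := fun z => ∫ y in Iic z.1, θ (y, z.2)
  have h_test := H.integral_mul_fderiv (fun z => η z * P z)
    (η.contDiff.mul (contDiff_integral_Iic hθ hθc)) η.hasCompactSupport.mul_right (subset_univ _)
  have h_left (z : ℝ × ℝ) : u z * fderiv ℝ (fun z => η z * P z) z (1, 0) = θ z * u z := by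
    by_cases hz : z ∈ tsupport u
    · have h_eq : (fun z => η z * P z) =ᶠ[𝓝 z] P := by
        filter_upwards [h_one (Or.inl hz)] with w hw
        rw [hw, Pi.one_apply, one_mul]
      rw [h_eq.fderiv_eq, fderiv_integral_Iic_dx hθ hθc, mul_comm]
    · rw [image_eq_zero_of_notMem_tsupport hz, zero_mul, mul_zero]
  have h_right (z : ℝ × ℝ) : g z * (η z * P z) = g z * P z := by
    by_cases hz : z ∈ tsupport g
    · rw [(h_one (Or.inr hz)).eq_of_nhds, Pi.one_apply, one_mul]
    · rw [image_eq_zero_of_notMem_tsupport hz, zero_mul, zero_mul]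
  have h_fubini := integral_mul_integral_Iic_slice_eq H.stronglyMeasurable_dx H.integrable_dx hθ hθc
  simp only [h_left, h_right] at h_test
  simp only [Pi.add_apply, smul_eq_mul, mul_add]
  rw [integral_add, h_test.trans (congrArg Neg.neg h_fubini), neg_add_cancel]
  · exact H.integrable.locallyIntegrable.integrable_smul_left_of_hasCompactSupport
      hθ.continuous hθc
  · exact h_locInt.integrable_smul_left_of_hasCompactSupport hθ.continuous hθc

-- Cut `u` off near the compact segment; there the cutoff is `1`, so that the derivatives agree.
lemma ae_exists_eq_sub_integral_Ici_of_Icc (H : HasWeakDx U u g) (hU : IsOpen U)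
    (hUb : Bornology.IsBounded U) :
    ∀ᵐ t : ℝ, ∀ a b, Icc a b ⊆ timeSlice U t →
      ∃ m, ∀ᵐ x : ℝ, x ∈ Icc a b → u (x, t) = m - ∫ y in Ici x, g (y, t) := by
  obtain ⟨χ, hχ, hχU, hχ_one⟩ := exists_seq_cutoff hU
  have hχc (n : ℕ) : HasCompactSupport (χ n) :=
    (Metric.isCompact_of_isClosed_isBounded (isClosed_tsupport _) (hUb.subset (hχU n)))
  have h_cut (n : ℕ) := H.mul_cutoff (hχ n) (hχc n) (hχU n)
  have h_global (n : ℕ) := (h_cut n).ae_eq_neg_integral_Ici (hχc n).mul_left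
    ((hχc n).mul_left.add ((hχc n).fderiv_apply ℝ _).mul_left)
  filter_upwards [ae_integrable_slice H.integrable_dx,
    ae_all_iff.2 fun n => ae_integrable_slice (h_cut n).integrable_dx,
    ae_all_iff.2 fun n => ae_ae_slice (h_global n)] with t hg h_int h_eq a b hab
  obtain ⟨n, hn⟩ := hχ_one ((fun x => (x, t)) '' Icc a b) (image_subset_iff.2 hab)
    (isCompact_Icc.image (by fun_prop))
  simp only [forall_mem_image] at hn
  set G : ℝ → ℝ := fun y => g (y, t) * χ n (y, t) + u (y, t) * fderiv ℝ (χ n) (y, t) (1, 0)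
  have hG : ∀ y ∈ Icc a b, G y = g (y, t) := fun y hy => by
    simp [G, (hn hy).eq_of_nhds, (hn hy).fderiv_eq]
  refine ⟨(∫ y in Ici b, g (y, t)) - ∫ y in Ici b, G y, ?_⟩
  filter_upwards [h_eq n] with x hx hxI
  have h_congr : ∫ y in b..x, G y = ∫ y in b..x, g (y, t) :=
    intervalIntegral.integral_congr fun y hy => hG y <| by
      rw [uIcc_of_ge hxI.2] at hy
      exact ⟨hxI.1.trans hy.1, hy.2⟩
  rw [(hn hxI).eq_of_nhds, Pi.one_apply, mul_one] at hx
  rw [hx, integral_Ici_eq (h_int n) b x, integral_Ici_eq hg b x, h_congr]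
  ring

end HasWeakDx

lemma exists_ae_eq_const_of_forall_Icc {w : ℝ → ℝ} {a b : ℝ} (hab : a < b)
    (h : ∀ c d, Icc c d ⊆ Ioo a b → ∃ m, ∀ᵐ x : ℝ, x ∈ Icc c d → w x = m) :
    ∃ m, ∀ᵐ x : ℝ, x ∈ Ioo a b → w x = m := by
  obtain ⟨p, hap, hpb⟩ := exists_between hab
  obtain ⟨c, -, hc, hc_lim⟩ := exists_seq_strictAnti_tendsto' hap
  obtain ⟨d, -, hd, hd_lim⟩ := exists_seq_strictMono_tendsto' hpb
  choose m hm using fun n => h (c n) (d n) fun x hx =>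
    ⟨(hc n).1.trans_le hx.1, hx.2.trans_lt (hd n).2⟩
  have h_const (n : ℕ) : m n = m 0 := by
    obtain ⟨x, ⟨hxn, hx0⟩, hx⟩ := (Measure.dense_of_ae ((hm n).and (hm 0))).exists_between
      (max_lt (hc n).2 (hc 0).2 |>.trans (lt_min (hd n).1 (hd 0).1))
    rw [← hxn ⟨(le_max_left _ _).trans hx.1.le, hx.2.le.trans (min_le_left _ _)⟩,
      hx0 ⟨(le_max_right _ _).trans hx.1.le, hx.2.le.trans (min_le_right _ _)⟩]
  refine ⟨m 0, ?_⟩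
  filter_upwards [ae_all_iff.2 hm] with x hx hxI
  obtain ⟨n, hcn, hdn⟩ := ((hc_lim.eventually_lt_const hxI.1).and
    (hd_lim.eventually_const_lt hxI.2)).exists
  rw [hx n ⟨hcn.le, hdn.le⟩, h_const]

lemma HasWeakDx.ae_exists_eq_sub_integral_Ici {U : Set (ℝ × ℝ)} {u g : ℝ × ℝ → ℝ}
    (H : HasWeakDx U u g) (hU : IsOpen U) (hUb : Bornology.IsBounded U) :
    ∀ᵐ t : ℝ, ∀ a b, a < b → Ioo a b ⊆ timeSlice U t →
      ∃ m, ∀ᵐ x : ℝ, x ∈ Ioo a b → u (x, t) = m - ∫ y in Ici x, g (y, t) := by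
  filter_upwards [H.ae_exists_eq_sub_integral_Ici_of_Icc hU hUb] with t ht a b hab h_sub
  obtain ⟨m, hm⟩ := exists_ae_eq_const_of_forall_Icc
    (w := fun x => u (x, t) + ∫ y in Ici x, g (y, t)) hab fun c d hcd =>
      (ht c d (hcd.trans h_sub)).imp fun m hm => hm.mono fun x hx hxI => by
        rw [hx hxI, sub_add_cancel]
  exact ⟨m, hm.mono fun x hx hxI => eq_sub_of_add_eq (hx hxI)⟩

lemma integral_mul_primitive_add {f g : ℝ → ℝ} {a b : ℝ} (hf : IntervalIntegrable f volume a b)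
    (hg : IntervalIntegrable g volume a b) :
    ∫ x in a..b, (f x * (∫ y in a..x, g y) + (∫ y in a..x, f y) * g x) =
      (∫ x in a..b, f x) * ∫ x in a..b, g x := by
  have h_parts := (hf.absolutelyContinuousOnInterval_intervalIntegral
    left_mem_uIcc).integral_deriv_mul_eq_sub
      (hg.absolutelyContinuousOnInterval_intervalIntegral left_mem_uIcc)
  simp only [intervalIntegral.integral_same, zero_mul, sub_zero] at h_parts
  rw [← h_parts]
  refine intervalIntegral.integral_congr_ae ?_
  filter_upwards [hf.ae_hasDerivAt_integral, hg.ae_hasDerivAt_integral] with x hf_x hg_x hx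
  have hx' := uIoc_subset_uIcc hx
  rw [(hf_x hx' a left_mem_uIcc).deriv, (hg_x hx' a left_mem_uIcc).deriv]

lemma integral_Ioo_eq_zero_of_primitive {f g u h : ℝ → ℝ} {a b m : ℝ} (hab : a < b)
    (hf : Integrable f) (hg : Integrable g)
    (hu : ∀ᵐ x : ℝ, x ∈ Ioo a b → u x = m - ∫ y in Ici x, g y)
    (hh : ∀ᵐ x : ℝ, h x = -∫ y in Ici x, f y)
    (ha : ∫ y in Ici a, f y = 0) (hb : ∫ y in Ici b, f y = 0) :
    ∫ x in Ioo a b, (f x * u x + h x * g x) = 0 := by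
  set M := m - ∫ y in Ici a, g y
  have h_total : ∫ y in a..b, f y = 0 := by
    have := integral_Ici_eq hf a b
    rw [ha, hb] at this
    linarith
  have hf' : IntervalIntegrable f volume a b := hf.intervalIntegrable
  have hg' : IntervalIntegrable g volume a b := hg.intervalIntegrable
  have h_cont {f : ℝ → ℝ} (hf : Integrable f) : Continuous fun x => ∫ y in a..x, f y :=
    intervalIntegral.continuous_primitive (fun _ _ => hf.intervalIntegrable) a
  rw [← integral_Ioc_eq_integral_Ioo, ← intervalIntegral.integral_of_le hab.le]
  calc ∫ x in a..b, (f x * u x + h x * g x)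
      = ∫ x in a..b, (M * f x + (f x * (∫ y in a..x, g y) + (∫ y in a..x, f y) * g x)) := by
        refine intervalIntegral.integral_congr_ae ?_
        filter_upwards [hu, hh, Measure.ae_ne volume b] with x hu_x hh_x hxb hx
        rw [uIoc_of_le hab.le] at hx
        rw [hu_x ⟨hx.1, lt_of_le_of_ne hx.2 hxb⟩, hh_x, integral_Ici_eq hf a x,
          integral_Ici_eq hg a x, ha]
        ring
    _ = 0 := by
        rw [intervalIntegral.integral_add (hf'.const_mul M), integral_mul_primitive_add hf' hg',
          intervalIntegral.integral_const_mul, h_total, mul_zero, zero_mul, add_zero]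
        exact (hf'.mul_continuousOn (h_cont hg).continuousOn).add
          (hg'.continuousOn_mul (h_cont hf).continuousOn)

lemma HasSeparatedBoundary.eq_zero_of_ae_notMem {δ : ℝ} (hδ : 0 < δ) {A : Set ℝ}
    (hA : HasSeparatedBoundary δ A) {F : ℝ → ℝ} (hF : Continuous F)
    (h_zero : ∀ᵐ x : ℝ, x ∉ A → F x = 0) {x : ℝ} (hx : x ∈ frontier A) : F x = 0 := by
  obtain ⟨e, he, h_disj⟩ := hA.exists_outer x hx
  have hne : x ≠ e := by
    rintro rfl
    rw [sub_self, abs_zero] at he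
    linarith
  have h_open : IsOpen (uIoo x e) := isOpen_Ioo
  have h_ae : F =ᵐ[volume.restrict (uIoo x e)] fun _ => 0 := by
    filter_upwards [ae_restrict_of_ae h_zero, ae_restrict_mem h_open.measurableSet] with y hy hyI
    exact hy (disjoint_left.1 h_disj hyI)
  have h_closure := (Measure.eqOn_open_of_ae_eq h_ae h_open hF.continuousOn
    continuousOn_const).closure hF continuous_const
  refine h_closure ?_
  rw [uIoo, closure_Ioo (by simpa using hne)]
  exact left_mem_uIcc

lemma setIntegral_eq_zero_of_forall_Ioo {A : Set ℝ} {w : ℝ → ℝ} (hA : IsOpen A)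
    (hAb : Bornology.IsBounded A) (hw : IntegrableOn w A)
    (h_zero : ∀ a ∈ frontier A, ∀ b ∈ frontier A, a < b → Ioo a b ⊆ A → ∫ x in Ioo a b, w x = 0) :
    ∫ x in A, w x = 0 := by
  let ι := {p : ℝ × ℝ // (p.1 ∈ frontier A ∧ p.2 ∈ frontier A) ∧ p.1 < p.2 ∧ Ioo p.1 p.2 ⊆ A}
  have h_notMem {x : ℝ} (hx : x ∈ frontier A) : x ∉ A := (hA.frontier_eq ▸ hx).2
  have h_disj : Pairwise fun p q : ι => Disjoint (Ioo p.1.1 p.1.2) (Ioo q.1.1 q.1.2) := by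
    refine fun p q hpq => disjoint_left.2 fun x hp hq => hpq (Subtype.ext (Prod.ext ?_ ?_))
    · exact le_antisymm
        (not_lt.1 fun h => h_notMem p.2.1.1 (q.2.2.2 ⟨h, hp.1.trans hq.2⟩))
        (not_lt.1 fun h => h_notMem q.2.1.1 (p.2.2.2 ⟨h, hq.1.trans hp.2⟩))
    · exact le_antisymm
        (not_lt.1 fun h => h_notMem q.2.1.2 (p.2.2.2 ⟨hp.1.trans hq.2, h⟩))
        (not_lt.1 fun h => h_notMem p.2.1.2 (q.2.2.2 ⟨hq.1.trans hp.2, h⟩))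
  have h_countable : Countable ι := h_disj.countable_of_isOpen_disjoint
    (fun _ => isOpen_Ioo) fun p => nonempty_Ioo.2 p.2.2.1
  have h_union : A = ⋃ p : ι, Ioo p.1.1 p.1.2 := by
    refine Subset.antisymm (fun x hx => ?_) (iUnion_subset fun p => p.2.2.2)
    obtain ⟨a, ha, hax, h_left⟩ := exists_mem_frontier_Ioc_subset hA hAb.bddBelow hx
    obtain ⟨b, hb, hxb, h_right⟩ := exists_mem_frontier_Ico_subset hA hAb.bddAbove hx
    refine mem_iUnion.2 ⟨⟨(a, b), ⟨ha, hb⟩, hax.trans hxb, ?_⟩, hax, hxb⟩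
    rw [← Ioc_union_Ico_eq_Ioo hax hxb]
    exact union_subset h_left h_right
  rw [h_union] at hw ⊢
  rw [integral_iUnion (fun _ => measurableSet_Ioo) h_disj hw]
  exact (tsum_congr fun p => h_zero _ p.2.1.1 _ p.2.1.2 p.2.2.1 p.2.2.2).trans tsum_zero

-- On every component `(a, b)` of a slice `h` is a primitive of `f` that vanishes at both ends,
-- because the boundary of the slice is separated, so no boundary term remains.
theorem HasWeakDx.integral_mul_add_mul_eq_zero {Q : Set (ℝ × ℝ)} {f h u g : ℝ × ℝ → ℝ} {δ : ℝ}
    (Hu : HasWeakDx Q u g) (Hh : HasWeakDx univ h f) (hQ : IsOpen Q)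
    (hQb : Bornology.IsBounded Q) (hδ : 0 < δ)
    (h_sep : ∀ᵐ t : ℝ, HasSeparatedBoundary δ (timeSlice Q t))
    (hf_zero : ∀ z ∉ Q, f z = 0) (hh_zero : ∀ z ∉ Q, h z = 0)
    (hfu : Integrable fun z => f z * u z) (hhg : Integrable fun z => h z * g z) :
    ∫ z, (f z * u z + h z * g z) = 0 := by
  have h_compact {v : ℝ × ℝ → ℝ} (hv : ∀ z ∉ Q, v z = 0) : HasCompactSupport v :=
    HasCompactSupport.intro hQb.isCompact_closure fun z hz => hv z fun h => hz (subset_closure h)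
  have h_int : Integrable fun z => f z * u z + h z * g z := hfu.add hhg
  rw [Measure.volume_eq_prod, integral_prod_symm _ h_int]
  refine integral_eq_zero_of_ae ?_
  filter_upwards [h_sep,
    ae_ae_slice (Hh.ae_eq_neg_integral_Ici (h_compact hh_zero) (h_compact hf_zero)),
    Hu.ae_exists_eq_sub_integral_Ici hQ hQb, ae_integrable_slice Hh.integrable_dx,
    ae_integrable_slice Hu.integrable_dx, ae_integrable_slice h_int]
    with t hA hht hut hft hgt h_int_t
  have h_primitive : ∀ x ∈ frontier (timeSlice Q t), ∫ y in Ici x, f (y, t) = 0 := fun x hx =>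
    hA.eq_zero_of_ae_notMem hδ (continuous_integral_Ici hft)
      (hht.mono fun y hy hyA => neg_eq_zero.1 (hy.symm.trans (hh_zero _ hyA))) hx
  have h_off (x : ℝ) (hx : x ∉ timeSlice Q t) :
      f (x, t) * u (x, t) + h (x, t) * g (x, t) = 0 := by
    rw [hf_zero _ hx, hh_zero _ hx, zero_mul, zero_mul, add_zero]
  rw [Pi.zero_apply, ← setIntegral_eq_integral_of_forall_compl_eq_zero h_off]
  refine setIntegral_eq_zero_of_forall_Ioo (isOpen_timeSlice hQ t)
    (isBounded_timeSlice hQb t) h_int_t.integrableOn fun a ha b hb hab h_sub => ?_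
  obtain ⟨m, hm⟩ := hut a b hab h_sub
  exact integral_Ioo_eq_zero_of_primitive (f := fun x => f (x, t)) (g := fun x => g (x, t))
    (u := fun x => u (x, t)) (h := fun x => h (x, t)) hab hft hgt hm hht (h_primitive a ha)
    (h_primitive b hb)

section WeakDerivative

variable {Q : Set (ℝ × ℝ)} {φ ψ : ℝ × ℝ → ℝ} {u g k : L2 Q}

lemma setIntegral_mul_of_tsupport_subset (f : ℝ × ℝ → ℝ) (hs : tsupport ψ ⊆ Q) :
    ∫ z in Q, f z * ψ z = ∫ z, f z * ψ z :=
  setIntegral_eq_integral_of_forall_compl_eq_zero fun z hz => by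
    rw [image_eq_zero_of_notMem_tsupport fun h => hz (hs h), mul_zero]

lemma integrable_mul_of_continuousOn (hφ : ContinuousOn φ Q) (hψ : Continuous ψ)
    (hc : HasCompactSupport ψ) (hs : tsupport ψ ⊆ Q) : Integrable fun z => φ z * ψ z :=
  (integrableOn_iff_integrable_of_support_subset
    ((Function.support_mul_subset_right φ ψ).trans (subset_tsupport ψ))).1
    (((hφ.mono hs).mul hψ.continuousOn).integrableOn_compact hc)

lemma continuousOn_fderiv_dx (hQ : IsOpen Q) (hφ : ContDiffOn ℝ 1 φ Q) :
    ContinuousOn (fun z => fderiv ℝ φ z (1, 0)) Q :=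
  (hφ.continuousOn_fderiv_of_isOpen hQ le_rfl).clm_apply continuousOn_const

lemma setIntegral_mul_fderiv_dx (hQ : IsOpen Q) (hφ : ContDiffOn ℝ 1 φ Q) (hψ : ContDiff ℝ ∞ ψ)
    (hc : HasCompactSupport ψ) (hs : tsupport ψ ⊆ Q) :
    ∫ z in Q, φ z * fderiv ℝ ψ z (1, 0) = -∫ z in Q, fderiv ℝ φ z (1, 0) * ψ z := by
  have hs' := (tsupport_fderiv_apply_subset ℝ (1, 0)).trans hs
  rw [setIntegral_mul_of_tsupport_subset _ hs, setIntegral_mul_of_tsupport_subset _ hs']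
  exact integral_mul_fderiv_eq_neg_fderiv_mul_of_integrable
    (integrable_mul_of_continuousOn (continuousOn_fderiv_dx hQ hφ) hψ.continuous hc hs)
    (integrable_mul_of_continuousOn hφ.continuousOn (continuous_dx_test hψ)
      (hc.fderiv_apply ℝ _) hs')
    (integrable_mul_of_continuousOn hφ.continuousOn hψ.continuous hc hs)
    (fun z hz => (hφ.differentiableOn (by simp)).differentiableAt (hQ.mem_nhds (hs hz)))
    fun z _ => hψ.differentiable (by simp) z

lemma isWeakDx_of_ae_eq (hQ : IsOpen Q) (hφ : ContDiffOn ℝ 1 φ Q)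
    (hu : u =ᵐ[volume.restrict Q] φ)
    (hg : g =ᵐ[volume.restrict Q] fun z => fderiv ℝ φ z (1, 0)) : IsWeakDx Q u g := by
  intro ψ hψ hc hs
  rw [integral_congr_ae (hu.mono fun z hz => by rw [hz]),
    integral_congr_ae (f := fun z => g z * ψ z) (hg.mono fun z hz => by beta_reduce; rw [hz]),
    setIntegral_mul_fderiv_dx hQ hφ hψ hc hs]

lemma ae_eq_fderiv_of_isWeakDx (hQ : IsOpen Q) (hφ : ContDiffOn ℝ 1 φ Q)
    (hu : u =ᵐ[volume.restrict Q] φ) (hg : IsWeakDx Q u g) :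
    g =ᵐ[volume.restrict Q] fun z => fderiv ℝ φ z (1, 0) := by
  have h_cont := continuousOn_fderiv_dx hQ hφ
  have h_locInt : LocallyIntegrableOn (fun z => g z - fderiv ℝ φ z (1, 0)) Q
      (volume.restrict Q) :=
    (((Lp.memLp g).locallyIntegrable (by norm_num)).locallyIntegrableOn Q).sub
      (h_cont.locallyIntegrableOn hQ.measurableSet)
  have h_ae := hQ.ae_eq_zero_of_integral_contDiff_smul_eq_zero h_locInt fun ψ hψ hc hs => by
    have h_parts := hg ψ hψ hc hs
    rw [integral_congr_ae (hu.mono fun z hz => by rw [hz]),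
      setIntegral_mul_fderiv_dx hQ hφ hψ hc hs] at h_parts
    simp only [smul_eq_mul, mul_comm (ψ _), sub_mul]
    rw [integral_sub (integrable_mul_test g hψ.continuous hc)
      (integrable_mul_of_continuousOn h_cont hψ.continuous hc hs).integrableOn,
      neg_injective h_parts, sub_self]
  filter_upwards [h_ae, ae_restrict_mem hQ.measurableSet] with z hz hzQ
  exact sub_eq_zero.1 (hz hzQ)

lemma isWeakDx_unique (hQ : IsOpen Q) (hg : IsWeakDx Q u g) (hk : IsWeakDx Q u k) : g = k := by
  have h_diff : IsWeakDx Q 0 (g - k) := by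
    simpa [← sub_eq_add_neg] using hg.add (hk.smul (-1))
  have h_ae := ae_eq_fderiv_of_isWeakDx hQ (φ := fun _ => 0) contDiffOn_const
    (Lp.coeFn_zero _ _ _) h_diff
  rw [← sub_eq_zero]
  refine Lp.ext (h_ae.trans ((Lp.coeFn_zero ℝ 2 (volume.restrict Q)).mono fun z hz => ?_))
  rw [hz]
  simp

lemma isWeakDx_dx (u : H10 Q) : IsWeakDx Q u (dx u) :=
  Classical.choose_spec u.2

/-- The map `u ↦ (u, ∂ₓ u)`. It embeds `H^{1,0}(Q)` into a Hilbert space, whose norm stands in for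
the equivalent norm `h10Norm`. -/
noncomputable def graphMap (hQ : IsOpen Q) : H10 Q →ₗ[ℝ] WithLp 2 (L2 Q × L2 Q) where
  toFun u := WithLp.toLp 2 ((u : L2 Q), dx u)
  map_add' u v := by
    rw [isWeakDx_unique hQ (isWeakDx_dx (u + v)) ((isWeakDx_dx u).add (isWeakDx_dx v))]
    rfl
  map_smul' r u := by
    rw [isWeakDx_unique hQ (isWeakDx_dx (r • u)) ((isWeakDx_dx u).smul r)]
    rfl

lemma norm_graphMap_sq (hQ : IsOpen Q) (u : H10 Q) :
    ‖graphMap hQ u‖ ^ 2 = ‖(u : L2 Q)‖ ^ 2 + ‖dx u‖ ^ 2 :=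
  WithLp.prod_norm_sq_eq_of_L2 _

lemma norm_graphMap_le_h10Norm (hQ : IsOpen Q) (u : H10 Q) : ‖graphMap hQ u‖ ≤ h10Norm u := by
  refine Real.le_sqrt_of_sq_le ?_
  rw [norm_graphMap_sq]
  exact le_add_of_nonneg_right (sq_nonneg _)

lemma h10Norm_le_two_mul_norm_graphMap (hQ : IsOpen Q) (u : H10 Q) :
    h10Norm u ≤ 2 * ‖graphMap hQ u‖ := by
  refine Real.sqrt_le_iff.2 ⟨by positivity, ?_⟩
  rw [mul_pow, norm_graphMap_sq]
  nlinarith [sq_nonneg ‖(u : L2 Q)‖, sq_nonneg ‖dx u‖]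

end WeakDerivative

section Density

variable {Q : Set (ℝ × ℝ)}

/-- The elements of `H^{1,0}(Q)` that are represented by a function in `C¹(closure Q)`. -/
def classicalH10 (Q : Set (ℝ × ℝ)) : Submodule ℝ (H10 Q) where
  carrier := {u | ∃ φ : ℝ × ℝ → ℝ, ContDiffOn ℝ 1 φ (closure Q) ∧
    ((u : L2 Q) : ℝ × ℝ → ℝ) =ᵐ[volume.restrict Q] φ}
  zero_mem' := ⟨0, contDiffOn_const, Lp.coeFn_zero _ _ _⟩
  add_mem' := fun ⟨φ, hφ, hu⟩ ⟨ψ, hψ, hv⟩ =>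
    ⟨φ + ψ, hφ.add hψ, (Lp.coeFn_add _ _).trans (hu.add hv)⟩
  smul_mem' := fun r _ ⟨φ, hφ, hu⟩ =>
    ⟨r • φ, hφ.const_smul r, (Lp.coeFn_smul r _).trans (hu.const_smul r)⟩

lemma exists_mem_classicalH10 (hQ : IsOpen Q) {φ : ℝ × ℝ → ℝ} (hφ : ContDiff ℝ ∞ φ)
    (hc : HasCompactSupport φ) :
    ∃ u ∈ classicalH10 Q, (u : L2 Q) =ᵐ[volume.restrict Q] φ ∧
      dx u =ᵐ[volume.restrict Q] fun z => fderiv ℝ φ z (1, 0) := by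
  have hφ₁ : ContDiff ℝ 1 φ := hφ.of_le (by exact_mod_cast le_top)
  have h_memLp : MemLp φ 2 (volume.restrict Q) :=
    (hφ.continuous.memLp_of_hasCompactSupport hc).restrict Q
  have h_memLp_dx : MemLp (fun z => fderiv ℝ φ z (1, 0)) 2 (volume.restrict Q) :=
    ((continuous_dx_test hφ).memLp_of_hasCompactSupport (hc.fderiv_apply ℝ _)).restrict Q
  let u : H10 Q := ⟨h_memLp.toLp φ, _,
    isWeakDx_of_ae_eq hQ hφ₁.contDiffOn h_memLp.coeFn_toLp h_memLp_dx.coeFn_toLp⟩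
  exact ⟨u, ⟨φ, hφ₁.contDiffOn, h_memLp.coeFn_toLp⟩, h_memLp.coeFn_toLp,
    ae_eq_fderiv_of_isWeakDx hQ hφ₁.contDiffOn h_memLp.coeFn_toLp (isWeakDx_dx u)⟩

lemma hasWeakDx_indicator (hQm : MeasurableSet Q) (hQb : Bornology.IsBounded Q)
    {U : Set (ℝ × ℝ)} {u g : L2 Q}
    (h_parts : ∀ φ : ℝ × ℝ → ℝ, ContDiff ℝ ∞ φ → HasCompactSupport φ → tsupport φ ⊆ U →
      ∫ z in Q, u z * fderiv ℝ φ z (1, 0) = -∫ z in Q, g z * φ z) :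
    HasWeakDx U (Q.indicator u) (Q.indicator g) := by
  have : IsFiniteMeasure ((volume : Measure (ℝ × ℝ)).restrict Q) :=
    ⟨by rw [Measure.restrict_apply_univ]; exact hQb.measure_lt_top⟩
  have h_meas (v : L2 Q) : StronglyMeasurable (Q.indicator v) :=
    (Lp.stronglyMeasurable v).indicator hQm
  have h_int (v : L2 Q) : Integrable (Q.indicator v) :=
    (integrable_indicator_iff hQm).2 ((Lp.memLp v).integrable (by norm_num))
  have h_setIntegral (v : L2 Q) (ψ : ℝ × ℝ → ℝ) :
      ∫ z, Q.indicator v z * ψ z = ∫ z in Q, v z * ψ z := by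
    rw [← integral_indicator hQm]
    exact integral_congr_ae (ae_of_all _ fun z => (indicator_mul_left Q v ψ).symm)
  refine ⟨h_meas u, h_meas g, h_int u, h_int g, fun φ hφ hc hs => ?_⟩
  rw [h_setIntegral, h_setIntegral]
  exact h_parts φ hφ hc hs

lemma inner_graphMap (hQ : IsOpen Q) (w : WithLp 2 (L2 Q × L2 Q)) (u : H10 Q) :
    inner ℝ w (graphMap hQ u) =
      (∫ z in Q, w.fst z * (u : L2 Q) z) + ∫ z in Q, w.snd z * dx u z := by
  have h_inner (f g : L2 Q) : inner ℝ f g = ∫ z in Q, f z * g z := by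
    simp only [L2.inner_def, RCLike.inner_apply, conj_trivial, mul_comm]
  rw [← h_inner, ← h_inner]
  rfl

lemma hasWeakDx_indicator_of_mem_orthogonal (hQ : IsOpen Q) (hQb : Bornology.IsBounded Q)
    {w : WithLp 2 (L2 Q × L2 Q)} (hw : w ∈ ((classicalH10 Q).map (graphMap hQ))ᗮ) :
    HasWeakDx univ (Q.indicator w.snd) (Q.indicator w.fst) := by
  refine hasWeakDx_indicator hQ.measurableSet hQb fun φ hφ hc _ => ?_
  obtain ⟨v, hv_mem, hv, hv_dx⟩ := exists_mem_classicalH10 hQ hφ hc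
  have h_inner := (Submodule.mem_orthogonal' _ w).1 hw _ (Submodule.mem_map_of_mem hv_mem)
  rw [inner_graphMap, integral_congr_ae (hv.mono fun z hz => by rw [hz]),
    integral_congr_ae (f := fun z => w.snd z * dx v z)
      (hv_dx.mono fun z hz => by beta_reduce; rw [hz])] at h_inner
  exact eq_neg_of_add_eq_zero_right h_inner

theorem graphMap_mem_topologicalClosure (hQ : IsOpen Q) (hQb : Bornology.IsBounded Q) {δ : ℝ}
    (hδ : 0 < δ) (h_sep : ∀ᵐ t : ℝ, HasSeparatedBoundary δ (timeSlice Q t)) (u : H10 Q) :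
    graphMap hQ u ∈ ((classicalH10 Q).map (graphMap hQ)).topologicalClosure := by
  rw [← Submodule.orthogonal_orthogonal_eq_closure, Submodule.mem_orthogonal]
  intro w hw
  have h_mul (f v : L2 Q) : (fun z => Q.indicator f z * Q.indicator v z) =
      Q.indicator fun z => f z * v z := (indicator_mul Q f v).symm
  have h_int (f v : L2 Q) : Integrable fun z => Q.indicator f z * Q.indicator v z := by
    rw [h_mul, integrable_indicator_iff hQ.measurableSet]
    exact (Lp.memLp f).integrable_mul (Lp.memLp v)
  have h_zero := HasWeakDx.integral_mul_add_mul_eq_zero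
    (hasWeakDx_indicator hQ.measurableSet hQb (isWeakDx_dx u))
    (hasWeakDx_indicator_of_mem_orthogonal hQ hQb hw) hQ hQb hδ h_sep
    (fun z hz => indicator_of_notMem hz _) (fun z hz => indicator_of_notMem hz _)
    (h_int _ _) (h_int _ _)
  rw [integral_add (h_int _ _) (h_int _ _), h_mul, h_mul, integral_indicator hQ.measurableSet,
    integral_indicator hQ.measurableSet] at h_zero
  rwa [inner_graphMap]

lemma exists_seq_mem_classicalH10_tendsto (hQ : IsOpen Q) (hQb : Bornology.IsBounded Q) {δ : ℝ}
    (hδ : 0 < δ) (h_sep : ∀ᵐ t : ℝ, HasSeparatedBoundary δ (timeSlice Q t)) (u : H10 Q) :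
    ∃ w : ℕ → H10 Q, (∀ n, w n ∈ classicalH10 Q) ∧
      Tendsto (fun n => graphMap hQ (w n)) atTop (𝓝 (graphMap hQ u)) := by
  obtain ⟨x, hx, h_lim⟩ := mem_closure_iff_seq_limit.1
    (graphMap_mem_topologicalClosure hQ hQb hδ h_sep u)
  choose w hw hwx using hx
  exact ⟨w, hw, by simpa only [hwx] using h_lim⟩

end Density

section Trace

variable {Q : Set (ℝ × ℝ)} {φ : ℝ × ℝ → ℝ} {u : H10 Q}

lemma enorm_sq_eq_lintegral {α : Type*} [MeasurableSpace α] {μ : Measure α} (v : Lp ℝ 2 μ)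
    {f : α → ℝ} (h : v =ᵐ[μ] f) : ‖v‖ₑ ^ 2 = ∫⁻ z, ‖f z‖ₑ ^ 2 ∂μ := by
  rw [Lp.enorm_def, eLpNorm_congr_ae h]
  simpa using eLpNorm_nnreal_pow_eq_lintegral (μ := μ) (f := f) (p := 2) two_ne_zero

lemma hasClassicalDx_indicator (hQ : IsOpen Q) (hφ : ContDiffOn ℝ 1 φ (closure Q)) :
    HasClassicalDx Q ((closure Q).indicator φ) fun z => fderiv ℝ φ z (1, 0) where
  measurable := by
    classical
    rw [← piecewise_eq_indicator]
    exact hφ.continuousOn.measurable_piecewise continuousOn_const isClosed_closure.measurableSet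
  measurable_dx := measurable_fderiv_apply_const ℝ φ (1, 0)
  continuousOn := hφ.continuousOn.congr fun z hz => indicator_of_mem hz _
  hasDerivAt z hz := by
    have h_diff : DifferentiableAt ℝ φ z :=
      ((hφ.mono subset_closure).differentiableOn (by simp)).differentiableAt (hQ.mem_nhds hz)
    refine (hasDerivAt_fderiv_dx h_diff).congr_of_eventuallyEq ?_
    filter_upwards [(isOpen_timeSlice hQ z.2).mem_nhds hz] with x hx
    exact indicator_of_mem (subset_closure (show (x, z.2) ∈ Q from hx)) φ

lemma ae_arcLength_mem_closure (hQ : IsOpen Q) :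
    ∀ᵐ z ∂arcLength (lateralFrontier Q), z ∈ closure Q :=
  (ae_restrict_mem (measurableSet_lateralFrontier hQ)).mono fun _ hz =>
    lateralFrontier_subset_closure Q hz

lemma exists_hasClassicalDx (hQ : IsOpen Q) (hφ : ContDiffOn ℝ 1 φ (closure Q))
    (hu : (u : L2 Q) =ᵐ[volume.restrict Q] φ) :
    ∃ ψ q : ℝ × ℝ → ℝ, HasClassicalDx Q ψ q ∧ ψ =ᵐ[arcLength (lateralFrontier Q)] φ ∧
      ‖(u : L2 Q)‖ₑ ^ 2 = ∫⁻ z in Q, ‖ψ z‖ₑ ^ 2 ∧ ‖dx u‖ₑ ^ 2 = ∫⁻ z in Q, ‖q z‖ₑ ^ 2 := by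
  refine ⟨_, _, hasClassicalDx_indicator hQ hφ,
    (ae_arcLength_mem_closure hQ).mono fun z hz => indicator_of_mem hz _,
    enorm_sq_eq_lintegral _ (hu.trans ?_), enorm_sq_eq_lintegral _
      (ae_eq_fderiv_of_isWeakDx hQ (hφ.mono subset_closure) hu (isWeakDx_dx u))⟩
  filter_upwards [ae_restrict_mem hQ.measurableSet] with z hz
  exact (indicator_of_mem (subset_closure hz) φ).symm

/-- The pairs `(φ|_Q, φ|_S)` with `φ ∈ C¹(closure Q)`: the graph of the trace on smooth
functions. -/
def classicalTrace (Q S : Set (ℝ × ℝ)) : Submodule ℝ (H10 Q × L2Lateral S) where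
  carrier := {p | ∃ φ : ℝ × ℝ → ℝ, ContDiffOn ℝ 1 φ (closure Q) ∧
    ((p.1 : L2 Q) : ℝ × ℝ → ℝ) =ᵐ[volume.restrict Q] φ ∧ p.2 =ᵐ[arcLength S] φ}
  zero_mem' := ⟨0, contDiffOn_const, Lp.coeFn_zero _ _ _, Lp.coeFn_zero _ _ _⟩
  add_mem' := fun ⟨φ, hφ, hu, hv⟩ ⟨ψ, hψ, hu', hv'⟩ =>
    ⟨φ + ψ, hφ.add hψ, (Lp.coeFn_add _ _).trans (hu.add hu'),
      (Lp.coeFn_add _ _).trans (hv.add hv')⟩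
  smul_mem' := fun r _ ⟨φ, hφ, hu, hv⟩ =>
    ⟨r • φ, hφ.const_smul r, (Lp.coeFn_smul r _).trans (hu.const_smul r),
      (Lp.coeFn_smul r _).trans (hv.const_smul r)⟩

namespace IsTraceOperator

variable {S : Set (ℝ × ℝ)} {γ : H10 Q →ₗ[ℝ] L2Lateral S}

lemma mem_classicalTrace (hγ : IsTraceOperator Q S γ) (hu : u ∈ classicalH10 Q) :
    (u, γ u) ∈ classicalTrace Q S :=
  let ⟨φ, hφ, huφ⟩ := hu
  ⟨φ, hφ, huφ, hγ.2 φ hφ u huφ⟩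

lemma tendsto_of_tendsto_graphMap (hγ : IsTraceOperator Q S γ) (hQ : IsOpen Q) {w : ℕ → H10 Q}
    (hw : Tendsto (fun n => graphMap hQ (w n)) atTop (𝓝 (graphMap hQ u))) :
    Tendsto (fun n => γ (w n)) atTop (𝓝 (γ u)) := by
  obtain ⟨K, hK⟩ := hγ.1
  rw [tendsto_iff_norm_sub_tendsto_zero] at hw ⊢
  refine squeeze_zero (fun n => norm_nonneg _) (fun n => ?_)
    (by simpa using hw.const_mul (|K| * 2))
  rw [← map_sub, ← map_sub, mul_assoc]
  exact (hK _).trans (mul_le_mul (le_abs_self K) (h10Norm_le_two_mul_norm_graphMap hQ _)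
    (Real.sqrt_nonneg _) (abs_nonneg K))

end IsTraceOperator

namespace HasLateralCurves

variable {C K : ℝ≥0} {δ : ℝ} {F : Set ℝ} {N : ℕ} {c : Fin N → ℝ → ℝ}

lemma exists_seq_tendsto_graphMap (H : HasLateralCurves Q C δ F K c) (u : H10 Q) :
    ∃ w : ℕ → H10 Q, (∀ n, w n ∈ classicalH10 Q) ∧
      Tendsto (fun n => graphMap H.isOpen (w n)) atTop (𝓝 (graphMap H.isOpen u)) :=
  exists_seq_mem_classicalH10_tendsto H.isOpen H.isBounded H.pos H.ae_hasSeparatedBoundary u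

lemma memLp_arcLength (H : HasLateralCurves Q C δ F K c) (hφ : ContDiffOn ℝ 1 φ (closure Q))
    (hu : (u : L2 Q) =ᵐ[volume.restrict Q] φ) : MemLp φ 2 (arcLength (lateralFrontier Q)) := by
  obtain ⟨M, hM⟩ := H.exists_lintegral_arcLength_le
  obtain ⟨ψ, q, h_dx, hψ, hu_sq, hdu_sq⟩ := exists_hasClassicalDx H.isOpen hφ hu
  have h_bound := hM ψ q h_dx
  rw [← hu_sq, ← hdu_sq] at h_bound
  refine (memLp_congr_ae hψ).1 ⟨h_dx.measurable.aestronglyMeasurable,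
    (eLpNorm_lt_top_iff_lintegral_rpow_enorm_lt_top (by simp) (by simp)).2 ?_⟩
  simpa using h_bound.trans_lt (ENNReal.mul_lt_top ENNReal.coe_lt_top
    (ENNReal.add_lt_top.2 ⟨by simp, by simp⟩))

lemma exists_norm_le_norm_graphMap (H : HasLateralCurves Q C δ F K c) :
    ∃ M : ℝ≥0, ∀ p ∈ classicalTrace Q (lateralFrontier Q),
      ‖p.2‖ ≤ M * ‖graphMap H.isOpen p.1‖ := by
  obtain ⟨M, hM⟩ := H.exists_lintegral_arcLength_le
  refine ⟨NNReal.sqrt M, fun p ⟨φ, hφ, hu, hv⟩ => ?_⟩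
  obtain ⟨ψ, q, h_dx, hψ, hu_sq, hdu_sq⟩ := exists_hasClassicalDx H.isOpen hφ hu
  have h_bound := hM ψ q h_dx
  rw [← hu_sq, ← hdu_sq, ← enorm_sq_eq_lintegral p.2 (hv.trans hψ.symm)] at h_bound
  have h_real : ‖p.2‖ ^ 2 ≤ M * (‖(p.1 : L2 Q)‖ ^ 2 + ‖dx p.1‖ ^ 2) := by
    simp only [enorm_eq_nnnorm] at h_bound
    exact_mod_cast h_bound
  rw [← norm_graphMap_sq H.isOpen] at h_real
  refine (pow_le_pow_iff_left₀ (norm_nonneg _) (by positivity) two_ne_zero).1 ?_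
  rwa [mul_pow, ← NNReal.coe_pow, NNReal.sq_sqrt]

lemma norm_le_of_mem_classicalTrace (H : HasLateralCurves Q C δ F K c) {v}
    (h : (u, v) ∈ classicalTrace Q (lateralFrontier Q)) :
    ‖(u : L2 Q)‖ ≤ (2 * C + 1) * (‖dx u‖ + ‖v‖) := by
  obtain ⟨φ, hφ, hu, hv⟩ := h
  obtain ⟨ψ, q, h_dx, hψ, hu_sq, hdu_sq⟩ := exists_hasClassicalDx H.isOpen hφ hu
  have h_bound := H.lintegral_le_arcLength h_dx
  rw [← hu_sq, ← hdu_sq, ← enorm_sq_eq_lintegral v (hv.trans hψ.symm)] at h_bound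
  have h_real : ‖(u : L2 Q)‖ ^ 2 ≤ 2 * (C * ‖v‖ ^ 2) + 2 * (C ^ 2 * ‖dx u‖ ^ 2) := by
    simp only [enorm_eq_nnnorm] at h_bound
    exact_mod_cast h_bound
  have h_coeff : 2 * (C : ℝ) ≤ (2 * C + 1) ^ 2 ∧ 2 * (C : ℝ) ^ 2 ≤ (2 * C + 1) ^ 2 := by
    constructor <;> nlinarith [C.coe_nonneg]
  refine (pow_le_pow_iff_left₀ (norm_nonneg _) (by positivity) two_ne_zero).1 ?_
  calc ‖(u : L2 Q)‖ ^ 2 ≤ 2 * C * ‖v‖ ^ 2 + 2 * C ^ 2 * ‖dx u‖ ^ 2 := by linarith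
    _ ≤ (2 * C + 1) ^ 2 * ‖v‖ ^ 2 + (2 * C + 1) ^ 2 * ‖dx u‖ ^ 2 := by
      gcongr
      exacts [h_coeff.1, h_coeff.2]
    _ ≤ ((2 * C + 1) * (‖dx u‖ + ‖v‖)) ^ 2 := by
      nlinarith [mul_nonneg (sq_nonneg (2 * (C : ℝ) + 1))
        (mul_nonneg (norm_nonneg (dx u)) (norm_nonneg v))]

theorem exists_isTraceOperator (H : HasLateralCurves Q C δ F K c) :
    ∃ γ, IsTraceOperator Q (lateralFrontier Q) γ := by
  obtain ⟨M, hM⟩ := H.exists_norm_le_norm_graphMap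
  let G := classicalTrace Q (lateralFrontier Q)
  let E := ((classicalH10 Q).map (graphMap H.isOpen)).topologicalClosure
  let j : H10 Q →ₗ[ℝ] E := (graphMap H.isOpen).codRestrict E fun u =>
    graphMap_mem_topologicalClosure H.isOpen H.isBounded H.pos H.ae_hasSeparatedBoundary u
  let e : G →ₗ[ℝ] E := j ∘ₗ LinearMap.fst ℝ _ _ ∘ₗ G.subtype
  let γ₀ : G →ₗ[ℝ] L2Lateral (lateralFrontier Q) := LinearMap.snd ℝ _ _ ∘ₗ G.subtype
  have h_pair (φ u) (hφ : ContDiffOn ℝ 1 φ (closure Q))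
      (hu : ((u : H10 Q) : L2 Q) =ᵐ[volume.restrict Q] φ) :
      ∃ p : G, e p = j u ∧ γ₀ p =ᵐ[arcLength (lateralFrontier Q)] φ :=
    have h_memLp := H.memLp_arcLength hφ hu
    ⟨⟨(u, h_memLp.toLp φ), φ, hφ, hu, h_memLp.coeFn_toLp⟩, rfl, h_memLp.coeFn_toLp⟩
  have h_dense : DenseRange e := by
    intro x
    rw [closure_subtype]
    refine closure_mono ?_ x.2
    rintro _ ⟨u, ⟨φ, hφ, hu⟩, rfl⟩
    obtain ⟨p, hp, -⟩ := h_pair φ u hφ hu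
    exact ⟨e p, mem_range_self p, congrArg Subtype.val hp⟩
  have h_norm (p) : ‖γ₀ p‖ ≤ M * ‖e p‖ := hM p p.2
  refine ⟨(γ₀.extendOfNorm e).toLinearMap ∘ₗ j, ⟨M, fun u => ?_⟩, fun φ hφ u hu => ?_⟩
  · exact (LinearMap.norm_extendOfNorm_apply_le h_dense M h_norm (j u)).trans
      (mul_le_mul_of_nonneg_left (norm_graphMap_le_h10Norm H.isOpen u) M.coe_nonneg)
  · obtain ⟨p, hp, hpφ⟩ := h_pair φ u hφ hu
    have h_ext : γ₀.extendOfNorm e (j u) = γ₀ p := by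
      rw [← hp, LinearMap.extendOfNorm_eq h_dense ⟨M, h_norm⟩]
    change γ₀.extendOfNorm e (j u) =ᵐ[arcLength (lateralFrontier Q)] φ
    rwa [h_ext]

theorem existsUnique_isTraceOperator (H : HasLateralCurves Q C δ F K c) :
    ∃! γ, IsTraceOperator Q (lateralFrontier Q) γ := by
  refine existsUnique_of_exists_of_unique H.exists_isTraceOperator fun γ γ' hγ hγ' =>
    LinearMap.ext fun u => ?_
  obtain ⟨w, hw, h_lim⟩ := H.exists_seq_tendsto_graphMap u
  refine tendsto_nhds_unique (hγ.tendsto_of_tendsto_graphMap H.isOpen h_lim)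
    ((hγ'.tendsto_of_tendsto_graphMap H.isOpen h_lim).congr fun n => ?_)
  obtain ⟨φ, hφ, hwφ⟩ := hw n
  exact Lp.ext ((hγ'.2 φ hφ _ hwφ).trans (hγ.2 φ hφ _ hwφ).symm)

theorem norm_le_of_isTraceOperator (H : HasLateralCurves Q C δ F K c)
    {γ : H10 Q →ₗ[ℝ] L2Lateral (lateralFrontier Q)}
    (hγ : IsTraceOperator Q (lateralFrontier Q) γ) (u : H10 Q) :
    ‖(u : L2 Q)‖ ≤ (2 * C + 1) * (‖dx u‖ + ‖γ u‖) := by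
  obtain ⟨w, hw, h_lim⟩ := H.exists_seq_tendsto_graphMap u
  have h_fst : Tendsto (fun n => (w n : L2 Q)) atTop (𝓝 u) :=
    ((WithLp.prod_continuous_ofLp 2 _ _).fst.tendsto _).comp h_lim
  have h_snd : Tendsto (fun n => dx (w n)) atTop (𝓝 (dx u)) :=
    ((WithLp.prod_continuous_ofLp 2 _ _).snd.tendsto _).comp h_lim
  have h_trace := hγ.tendsto_of_tendsto_graphMap H.isOpen h_lim
  exact le_of_tendsto_of_tendsto' h_fst.norm ((h_snd.norm.add h_trace.norm).const_mul _)
    fun n => H.norm_le_of_mem_classicalTrace (hγ.mem_classicalTrace (hw n))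

end HasLateralCurves

end Trace

theorem mainTheorem4 (CΩ : ℝ) (hCΩ : 0 < CΩ) :
    ∃ C : ℝ, 0 < C ∧
      ∀ (CdΩ T : ℝ) (Ω : ℝ → Set ℝ), 0 < CdΩ → 0 < T →
        (∀ t ∈ Set.Icc 0 T, IsOpen (Ω t) ∧ Bornology.IsBounded (Ω t)) →
        IsOpen (spaceTime Ω T) →
        UniformBounds Ω T CΩ CdΩ →
        HasLateralCharts (spaceTime Ω T) (lateral Ω T) →
        (∃! γ, IsTraceOperator (spaceTime Ω T) (lateral Ω T) γ) ∧
        ∀ γ, IsTraceOperator (spaceTime Ω T) (lateral Ω T) γ →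
          ∀ u : H10 (spaceTime Ω T),
            ‖(u : L2 (spaceTime Ω T))‖ ≤ C * (‖dx u‖ + ‖γ u‖) := by
  refine ⟨2 * CΩ + 1, by positivity, fun CdΩ T Ω _ _ hΩ hQ h_unif h_charts => ?_⟩
  rw [lateral_eq_lateralFrontier] at h_charts ⊢
  have h_slice (t : ℝ) : Bornology.IsBounded (timeSlice (spaceTime Ω T) t) ∧
      volume (timeSlice (spaceTime Ω T) t) ≤ CΩ.toNNReal := by
    by_cases ht : t ∈ Ioo 0 T
    · rw [timeSlice_spaceTime_of_mem ht]
      have ht' := Ioo_subset_Icc_self ht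
      exact ⟨(hΩ t ht').2, (h_unif t ht').1⟩
    · simp [timeSlice_spaceTime_of_notMem ht]
  obtain ⟨δ, F, N, K, c, H⟩ := exists_hasLateralCurves hQ (fun t => (h_slice t).1)
    (fun t => (h_slice t).2) h_charts
  refine ⟨H.existsUnique_isTraceOperator, fun γ hγ u => ?_⟩
  simpa only [Real.coe_toNNReal CΩ hCΩ.le] using H.norm_le_of_isTraceOperator hγ u
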